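/- **Setting.** Let $d\in\mathbb N$. For $\alpha,\beta\in\mathbb R$ and $f\in L_2(\mathbb T^d)$ with Fourier coefficients $\hat f_{\mathbf k}=\int_{\mathbb T^d}f(\mathbf x)e^{-2\pi i\mathbf k\cdot\mathbf x}\,d\mathbf x$ put $$\|f|\mathcal H^{\alpha,\beta}(\mathbb T^d)\|^2=\sum_{\mathbf k\in\mathbb Z^d}|\hat f_{\mathbf k}|^2(1+\|\mathbf k\|_2^2)^{\beta}\prod_{s=1}^d(1+|k_s|^2)^{\alpha},$$ let $\mathcal H^{\alpha,\beta}(\mathbb T^d)$ be the space of all $f\in L_2(\mathbb T^d)$ for which this is finite, and $\mathcal H^{\gamma}(\mathbb T^d)=\mathcal H^{0,\gamma}(\mathbb T^d)$. If $\min\{\alpha,\alpha+\beta\}>\frac12$, the elements of $\mathcal H^{\alpha,\beta}(\mathbb T^d)$ are identified with their continuous representatives. For $\mathbf z\in\mathbb Z^d$ and $M\in\mathbb N$, $M\ge1$, let $\Lambda(\mathbf z,M)=\{\frac jM\mathbf z\bmod\mathbf 1: 0\le j<M\}$. For a finite $I\subset\mathbb Z^d$ the sampling operator is $$S_I^{\Lambda(\mathbf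 z,M)}f=\sum_{\mathbf k\in I}\Big(\frac1M\sum_{j=0}^{M-1}f\big(\tfrac jM\mathbf z\big)e^{-2\pi i\frac jM\mathbf k\cdot\mathbf z}\Big)e^{2\pi i\mathbf k\cdot\circ},$$ and $\Lambda(\mathbf z,M)$ is a *reconstructing rank-1 lattice* for $I$ if $S_I^{\Lambda(\mathbf z,M)}p=p$ for all $p\in\operatorname{span}\{e^{2\pi i\mathbf k\cdot\circ}:\mathbf k\in I\}$. Let $Q_0=\{-1,0,1\}$, $Q_j=([-2^j,-2^{j-1}-1]\cup[2^{j-1}+1,2^j])\cap\mathbb Z$ for $j\ge1$, and let the dyadic hyperbolic cross $H_R^{d,0}$ be the union of $Q_{j_1}\times\dots\times Q_{j_d}$ over all $\mathbf j\in\mathbb N_0^d$ with $\|\mathbf j\|_1\le R+d-1$. A lattice $\Lambda(\mathbf z,M)$ is *constructed by the component-by-component (CBC) strategy* for $I$ if the components $z_1,\dots,z_d$ are chosen one after the other from $\{0,\dots,M-1\}$, each $z_s$ such that $k_1z_1+\dots+k_sz_s\not\equiv l_1z_1+\dots+l_sz_s\pmod M$ whenever $\mathbf k,\mathbf l\in I$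 and $(k_1,\dots,k_s)\ne(l_1,\dots,l_s)$, and if the lattice size satisfies $1\le M\le 2\max\{|\mathcal D(I)|,N_I\}$, where $\mathcal D(I)=\{\mathbf h-\mathbf h':\mathbf h,\mathbf h'\in I\}$ and $N_I=\max_{s}\max_{\mathbf h,\mathbf h'\in I}|h_s-h'_s|$. (For every prime $M>\max\{|\mathcal D(I)|,N_I\}$ each step of this search succeeds, and there is such a prime below the stated bound.) **Proposition.** Let $d\ge2$, $\alpha>\frac12$, $\beta\le0$, $\gamma\ge0$ and $\alpha+\beta>\max\{\gamma,\frac12\}$. There are constants $c,C_1,C_2>0$ depending only on $d,\alpha,\beta,\gamma$ such that for every real $R\ge1$ and every reconstructing rank-1 lattice $\Lambda(\mathbf z,M)$ for $H_R^{d,0}$ $$c\,M^{-(\alpha+\beta-\gamma)/2}\le\big\|\mathrm{Id}-S_{H_R^{d,0}}^{\Lambda(\mathbf z,M)}\,\big|\,\mathcal H^{\alpha,\beta}(\mathbb T^d)\to\mathcal H^{\gamma}(\mathbb T^d)\big\|\le C_1\,2^{-(\alpha+\beta-\gamma)R}\begin{cases}R^{(d-1)/2}&:\beta=0,\\1&:\beta<0,\end{cases}$$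 and, if in addition $\Lambda(\mathbf z,M)$ is constructed by the CBC strategy for $H_R^{d,0}$, then $$2^{-(\alpha+\beta-\gamma)R}\begin{cases}R^{(d-1)/2}&:\beta=0,\\1&:\beta<0\end{cases}\ \le\ C_2\,M^{-(\alpha+\beta-\gamma)/2}(\log M)^{(d-2)(\alpha+\beta-\gamma)/2}\begin{cases}(\log M)^{(d-1)/2}&:\beta=0,\\1&:\beta<0.\end{cases}$$ -/

import Mathlib

open MeasureTheory
open scoped ENNReal

noncomputable section

/-- The translation-invariant probability measure on the torus `𝕋^d`: the product of the normalized
Haar measures on the circle, which is the measure used by `UnitAddTorus.mFourierCoeff`. -/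
abbrev torusMeasure (d : ℕ) : Measure (UnitAddTorus (Fin d)) :=
  Measure.pi fun _ => AddCircle.haarAddCircle

/-- The square-integrable functions (classes) on the torus `𝕋^d`. -/
abbrev TorusL2 (d : ℕ) : Type :=
  Lp ℂ 2 (torusMeasure d)

/-- The Fourier weight `(1 + ‖k‖₂²)^β ∏ₛ (1 + |kₛ|²)^α`. -/
def hybridWeight {d : ℕ} (α β : ℝ) (k : Fin d → ℤ) : ℝ :=
  (1 + ∑ s, (k s : ℝ) ^ 2) ^ β * ∏ s, (1 + (k s : ℝ) ^ 2) ^ α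

/-- The norm of `f` in the hybrid Sobolev space `H^{α,β}(𝕋^d)`, as an extended nonnegative real:
`f ∈ L₂` belongs to `H^{α,β}` iff it is finite. The isotropic space is `H^γ = H^{0,γ}`. -/
def hybridNorm {d : ℕ} (α β : ℝ) (f : TorusL2 d) : ℝ≥0∞ :=
  (∑' k : Fin d → ℤ,
    ENNReal.ofReal (‖UnitAddTorus.mFourierCoeff f k‖ ^ 2 * hybridWeight α β k)) ^ (1 / 2 : ℝ)

open Classical in
/-- The continuous representative of an `L₂` class (`0` if there is none). It is unique if it
exists, and for `min (α, α + β) > 1/2` it exists for every element of `H^{α,β}`. -/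
def continuousRep {d : ℕ} (f : TorusL2 d) : C(UnitAddTorus (Fin d), ℂ) :=
  if h : ∃ g : C(UnitAddTorus (Fin d), ℂ), ContinuousMap.toLp 2 (torusMeasure d) ℂ g = f then
    h.choose
  else 0

/-- The `j`-th node `(j / M) z mod 1` of the rank-1 lattice `Λ(z, M)`. -/
def latticeNode {d : ℕ} (z : Fin d → ℤ) (M j : ℕ) : UnitAddTorus (Fin d) :=
  fun s => (((j : ℝ) / (M : ℝ) * (z s : ℝ) : ℝ) : UnitAddCircle)

/-- The lattice rule `(1/M) ∑_{j<M} g(x_j) exp(-2πi k·x_j)`, `x_j` the nodes of `Λ(z, M)`, that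
approximates the `k`-th Fourier coefficient of `g`. -/
def latticeCoeff {d : ℕ} (z : Fin d → ℤ) (M : ℕ) (g : C(UnitAddTorus (Fin d), ℂ))
    (k : Fin d → ℤ) : ℂ :=
  (1 / (M : ℂ)) * ∑ j ∈ Finset.range M,
    g (latticeNode z M j) * UnitAddTorus.mFourier (-k) (latticeNode z M j)

/-- The rank-1 lattice sampling operator `S_I^{Λ(z,M)}`. -/
def latticeSampling {d : ℕ} (z : Fin d → ℤ) (M : ℕ) (I : Finset (Fin d → ℤ))
    (g : C(UnitAddTorus (Fin d), ℂ)) : C(UnitAddTorus (Fin d), ℂ) :=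
  ∑ k ∈ I, latticeCoeff z M g k • UnitAddTorus.mFourier k

/-- `Λ(z, M)` is a reconstructing rank-1 lattice for `I`: the sampling operator reproduces every
trigonometric polynomial with frequencies in `I`. -/
def IsReconstructing {d : ℕ} (z : Fin d → ℤ) (M : ℕ) (I : Finset (Fin d → ℤ)) : Prop :=
  ∀ p ∈ Submodule.span ℂ
      ((fun k : Fin d → ℤ => UnitAddTorus.mFourier k) '' (I : Set (Fin d → ℤ))),
    latticeSampling z M I p = p

/-- The norm of `Id - S_I^{Λ(z,M)}` as an operator from `H^{α,β}(𝕋^d)` to `H^γ(𝕋^d)`. -/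
def samplingErrorNorm {d : ℕ} (α β γ : ℝ) (z : Fin d → ℤ) (M : ℕ) (I : Finset (Fin d → ℤ)) :
    ℝ≥0∞ :=
  ⨆ f : {f : TorusL2 d // hybridNorm α β f ≤ 1},
    hybridNorm 0 γ
      (f.1 - ContinuousMap.toLp 2 (torusMeasure d) ℂ (latticeSampling z M I (continuousRep f.1)))

/-- The dyadic blocks `Q₀ = {-1, 0, 1}` and
`Q_j = ([-2^j, -2^(j-1) - 1] ∪ [2^(j-1) + 1, 2^j]) ∩ ℤ` for `j > 0`. -/
def dyadicBlock (j : ℕ) : Set ℤ :=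
  if j = 0 then {-1, 0, 1}
  else Set.Icc (-2 ^ j) (-2 ^ (j - 1) - 1) ∪ Set.Icc (2 ^ (j - 1) + 1) (2 ^ j)

/-- The dyadic hyperbolic cross `H_R^{d,0}`: the union of the blocks `Q_{j₁} × ⋯ × Q_{j_d}` over
all `j ∈ ℕ₀^d` with `‖j‖₁ ≤ R + d - 1`. -/
def hyperbolicCrossSet (d : ℕ) (R : ℝ) : Set (Fin d → ℤ) :=
  {k | ∃ j : Fin d → ℕ, (∑ s, (j s : ℝ)) ≤ R + d - 1 ∧ ∀ s, k s ∈ dyadicBlock (j s)}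

theorem abs_le_of_mem_dyadicBlock {j : ℕ} {k : ℤ} (hk : k ∈ dyadicBlock j) : |k| ≤ 2 ^ j := by
  unfold dyadicBlock at hk
  split_ifs at hk with h
  · subst h
    simp only [Set.mem_insert_iff, Set.mem_singleton_iff] at hk
    rcases hk with rfl | rfl | rfl <;> norm_num
  · have h1 : (0 : ℤ) < 2 ^ (j - 1) := by positivity
    rcases hk with hk | hk <;> rw [abs_le] <;> constructor <;> linarith [hk.1, hk.2]

theorem hyperbolicCrossSet_finite (d : ℕ) (R : ℝ) : (hyperbolicCrossSet d R).Finite := by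
  refine (Set.Finite.pi' (t := fun _ : Fin d =>
    Set.Icc (-2 ^ ⌊R + d - 1⌋₊ : ℤ) (2 ^ ⌊R + d - 1⌋₊))
    (fun _ => Set.finite_Icc _ _)).subset ?_
  rintro k ⟨j, hj, hk⟩ s
  have h1 : (j s : ℝ) ≤ R + d - 1 :=
    (Finset.single_le_sum (f := fun s => (j s : ℝ)) (fun i _ => Nat.cast_nonneg _)
      (Finset.mem_univ s)).trans hj
  have h2 : j s ≤ ⌊R + d - 1⌋₊ := Nat.le_floor h1
  have h3 := (abs_le_of_mem_dyadicBlock (hk s)).trans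
    (pow_le_pow_right₀ (by norm_num : (1 : ℤ) ≤ 2) h2)
  exact abs_le.mp h3

/-- The dyadic hyperbolic cross `H_R^{d,0}` as a finite set. -/
def hyperbolicCross (d : ℕ) (R : ℝ) : Finset (Fin d → ℤ) :=
  (hyperbolicCrossSet_finite d R).toFinset

/-- The difference set `D(I) = {h - h' : h, h' ∈ I}`. -/
def differenceSet {d : ℕ} (I : Finset (Fin d → ℤ)) : Finset (Fin d → ℤ) :=
  (I ×ˢ I).image fun p => p.1 - p.2

/-- The extent `max_s (max_{k ∈ I} k_s - min_{k ∈ I} k_s)` of `I`. -/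
def freqExtent {d : ℕ} (I : Finset (Fin d → ℤ)) : ℕ :=
  (differenceSet I).sup fun k => Finset.univ.sup fun s => (k s).natAbs

/-- `Λ(z, M)` is a rank-1 lattice found by the component-by-component (CBC) search for the
frequency set `I`.

The components `z₁, z₂, …` are picked one after the other from `{0, …, M - 1}`, the component `z_s`
being any value for which the vectors `(k₁, …, k_s)`, `k ∈ I`, have pairwise distinct residues
`k₁ z₁ + ⋯ + k_s z_s` modulo `M` (so that `Λ((z₁, …, z_s), M)` is reconstructing for the projection
of `I` to the first `s` coordinates). The lattice size is any `M` in the range in which the search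
is guaranteed to meet a suitable one: for a prime `M` larger than the cardinality of the difference
set and than the extent of `I`, a component `z_s` exists in every step, and by Bertrand's
postulate there is such a prime below twice the larger one of these two numbers. -/
structure IsCBCLattice {d : ℕ} (z : Fin d → ℤ) (M : ℕ) (I : Finset (Fin d → ℤ)) : Prop where
  size_pos : 0 < M
  size_le : M ≤ 2 * max (differenceSet I).card (freqExtent I)
  component_mem : ∀ s, z s ∈ Set.Ico (0 : ℤ) M
  component_step : ∀ s : Fin d, ∀ k ∈ I, ∀ l ∈ I,
    (∑ i with i ≤ s, k i * z i) ≡ (∑ i with i ≤ s, l i * z i) [ZMOD M] → ∀ i ≤ s, k i = l i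

end

open MeasureTheory
open scoped ENNReal

/-! Put `T = ⌊R⌋ + d - 1` and `δ = α + β - γ`. The cross consists of the frequencies whose dyadic
level (the sum of the block indices) is at most `T`, and a lattice confuses two frequencies exactly
when their residues `m · z` agree modulo `M`.

Upper bound. The squared error splits into truncation off the cross and aliasing on it. Truncation
is a comparison of weights (`hybridWeight_zero_le_of_le_sum`). For aliasing, weighted Cauchy–Schwarz
over a residue class leaves the energy of `f` on that class times a sum of inverse weights. A
reconstructing lattice has at most one cross frequency per class, so the energies add up to at most
the norm of `f` (`sum_tsum_residueClass_le`). Moreover, two members of a class cannot differ by an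
element of the cross other than `0`; hence a dyadic box of level `T + i` holds only `O(2 ^ i)` of
them (`IsDyadicallySeparated.card_le`). As `α + β > 1/2`, the inverse weights then sum geometrically
in `i` (`exists_sum_inv_hybridWeight_le`). For `β < 0` the weight favours the axes, so the sum over
the block indices of one level stays bounded; for `β = 0` it contributes `T ^ (d - 1)`.

Lower bound. By pigeonhole, two frequencies on different coordinate axes, of length at most `√M`,
share a residue. The difference of their exponentials has vanishing sampling operator and is a
fooling function (`exists_small_relation`, `le_samplingErrorNorm_of_modEq`).

CBC bound. Here `M` is at most twice the larger of the cardinality of the difference set and the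
extent, which gives `O(4 ^ T * (T + 1) ^ (d - 2))` (`card_differenceSet_le`). Reconstruction forces
`2 ^ T ≤ M`, so `R` is `O(log M)`, and the size bound can be solved for `2 ^ (-R)`. -/

/-! ### Dyadic levels and the hyperbolic cross -/

/-- The index of the dyadic block that contains a frequency vector. -/
def dyadicIndex {d : ℕ} (m : Fin d → ℤ) (s : Fin d) : ℕ :=
  Nat.clog 2 (m s).natAbs

theorem abs_le_two_pow_dyadicIndex {d : ℕ} (m : Fin d → ℤ) (s : Fin d) :
    |m s| ≤ 2 ^ dyadicIndex m s := by
  have h := Nat.le_pow_clog (b := 2) (by norm_num) (m s).natAbs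
  rw [Int.abs_eq_natAbs]
  exact_mod_cast h

theorem dyadicIndex_le_of_abs_le {d : ℕ} {m : Fin d → ℤ} {s : Fin d} {j : ℕ}
    (h : |m s| ≤ 2 ^ j) : dyadicIndex m s ≤ j := by
  refine Nat.clog_le_of_le_pow ?_
  rw [Int.abs_eq_natAbs] at h
  exact_mod_cast h

theorem two_pow_lt_abs {d : ℕ} {m : Fin d → ℤ} {s : Fin d} {j : ℕ}
    (h : j < dyadicIndex m s) : 2 ^ j < |m s| := by
  have h := Nat.pow_lt_of_lt_clog h
  rw [Int.abs_eq_natAbs]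
  exact_mod_cast h

theorem mem_dyadicBlock_dyadicIndex {d : ℕ} (m : Fin d → ℤ) (s : Fin d) :
    m s ∈ dyadicBlock (dyadicIndex m s) := by
  have h1 := abs_le_two_pow_dyadicIndex m s
  unfold dyadicBlock
  split_ifs with h
  · rw [h, pow_zero, abs_le] at h1
    simp only [Set.mem_insert_iff, Set.mem_singleton_iff]
    omega
  · have h2 : 2 ^ (dyadicIndex m s - 1) < |m s| := two_pow_lt_abs (by omega)
    rw [abs_le] at h1
    rcases lt_abs.1 h2 with h2 | h2
    · exact Or.inr ⟨by omega, h1.2⟩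
    · exact Or.inl ⟨h1.1, by omega⟩

/-- `dyadicIndex` is the least exponent possible in each coordinate, so any witness can be replaced
by it. The left side of the real threshold is an integer, so only `⌊R⌋₊` matters. -/
theorem mem_hyperbolicCross_iff {d : ℕ} (hd : 1 ≤ d) {R : ℝ} (hR : 0 ≤ R) {k : Fin d → ℤ} :
    k ∈ hyperbolicCross d R ↔ ∑ s, dyadicIndex k s ≤ ⌊R⌋₊ + (d - 1) := by
  have key : ∀ n : ℕ, (n : ℝ) ≤ R + d - 1 ↔ n ≤ ⌊R⌋₊ + (d - 1) := by
    intro n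
    rw [← Nat.floor_add_natCast hR, Nat.le_floor_iff (by positivity), Nat.cast_sub hd]
    push_cast
    rw [add_sub_assoc]
  rw [hyperbolicCross, Set.Finite.mem_toFinset, ← key]
  push_cast
  constructor
  · rintro ⟨j, hj, hk⟩
    refine le_trans (Finset.sum_le_sum fun s _ => ?_) hj
    exact_mod_cast dyadicIndex_le_of_abs_le (abs_le_of_mem_dyadicBlock (hk s))
  · exact fun h => ⟨_, h, mem_dyadicBlock_dyadicIndex k⟩

/-! ### Counting separated points in dyadic boxes -/

theorem exists_le_sum_eq {ι : Type*} [Fintype ι] [DecidableEq ι] (j : ι → ℕ) (T : ℕ)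
    (hT : T ≤ ∑ s, j s) : ∃ l ≤ j, ∑ s, l s = T := by
  induction T with
  | zero => exact ⟨0, fun _ => Nat.zero_le _, by simp⟩
  | succ T ih =>
    obtain ⟨l, hl, hs⟩ := ih (by omega)
    obtain ⟨s, -, h⟩ := Finset.exists_lt_of_sum_lt (show ∑ s, l s < ∑ s, j s by omega)
    refine ⟨l + Pi.single s 1, fun t => ?_, by simp [Finset.sum_add_distrib, hs]⟩
    rcases eq_or_ne t s with rfl | hts
    · simpa using h
    · simpa [hts] using hl t

/-- Any two points of `L` that differ by less than a dyadic box of volume `2 ^ T` coincide. -/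
def IsDyadicallySeparated {d : ℕ} (L : Set (Fin d → ℤ)) (T : ℕ) : Prop :=
  ∀ m ∈ L, ∀ m' ∈ L, ∀ l : Fin d → ℕ, ∑ s, l s ≤ T → (∀ s, |m s - m' s| < 2 ^ l s) → m = m'

theorem isDyadicallySeparated_univ {d : ℕ} :
    IsDyadicallySeparated (Set.univ : Set (Fin d → ℤ)) 0 := by
  intro m _ m' _ l hl h
  funext s
  have h0 : l s = 0 := by
    have := Finset.single_le_sum (f := l) (fun i _ => Nat.zero_le _) (Finset.mem_univ s)
    omega
  have := h s
  rw [h0, pow_zero, Int.abs_lt_one_iff] at this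
  omega

/-- Cut the box into cells of side lengths `2 ^ l s` with `l ≤ j` of total level exactly `T`.
Separation allows at most one point per cell, so rounding down to the cell index is injective. -/
theorem IsDyadicallySeparated.card_le {d : ℕ} {L : Set (Fin d → ℤ)} {T : ℕ}
    (hL : IsDyadicallySeparated L T) {F : Finset (Fin d → ℤ)} (hF : ∀ m ∈ F, m ∈ L)
    {j : Fin d → ℕ} (hj : ∀ m ∈ F, ∀ s, |m s| ≤ 2 ^ j s) (hT : T ≤ ∑ s, j s) :
    F.card ≤ 3 ^ d * 2 ^ (∑ s, j s - T) := by
  obtain ⟨l, hlj, hl⟩ := exists_le_sum_eq j T hT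
  have h1 : F.card ≤ (Fintype.piFinset fun s =>
      Finset.Icc (-2 ^ (j s - l s) : ℤ) (2 ^ (j s - l s))).card := by
    refine Finset.card_le_card_of_injOn (fun m s => m s / 2 ^ l s) ?_ ?_
    · intro m hm
      simp only [Finset.mem_coe, Fintype.mem_piFinset, Finset.mem_Icc]
      intro s
      have hp : (2 : ℤ) ^ j s = 2 ^ (j s - l s) * 2 ^ l s := by
        rw [← pow_add, Nat.sub_add_cancel (hlj s)]
      have h := abs_le.1 (hj m hm s)
      rw [hp] at h
      have h0 : (0 : ℤ) < 2 ^ l s := by positivity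
      exact ⟨Int.le_ediv_of_mul_le h0 (by linarith), Int.ediv_le_of_le_mul h0 h.2⟩
    · intro m hm m' hm' h
      refine hL m (hF m hm) m' (hF m' hm') l hl.le fun s => ?_
      have hs := congrFun h s
      simp only at hs
      have h0 : (0 : ℤ) < 2 ^ l s := by positivity
      have e1 := Int.emod_add_mul_ediv (m s) (2 ^ l s)
      have e2 := Int.emod_add_mul_ediv (m' s) (2 ^ l s)
      have a1 := Int.emod_lt_of_pos (m s) h0
      have a2 := Int.emod_lt_of_pos (m' s) h0
      have b1 := Int.emod_nonneg (m s) h0.ne'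
      have b2 := Int.emod_nonneg (m' s) h0.ne'
      rw [hs] at e1
      rw [abs_lt]
      constructor <;> linarith
  -- The interval has `2 * 2 ^ (j s - l s) + 1` points, whence the factor `3` per coordinate.
  have h2 : ∀ s, (Finset.Icc (-2 ^ (j s - l s) : ℤ) (2 ^ (j s - l s))).card
      ≤ 3 * 2 ^ (j s - l s) := by
    intro s
    have h0 : (1 : ℤ) ≤ 2 ^ (j s - l s) := one_le_pow₀ (by norm_num)
    rw [Int.card_Icc]
    zify
    rw [Int.toNat_of_nonneg (by linarith)]
    linarith
  refine h1.trans ?_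
  rw [Fintype.card_piFinset]
  refine (Finset.prod_le_prod' fun s _ => h2 s).trans ?_
  rw [Finset.prod_mul_distrib, Finset.prod_const, Finset.card_univ, Fintype.card_fin,
    Finset.prod_pow_eq_pow_sum, ← hl, Finset.sum_tsub_distrib _ fun s _ => hlj s]

/-- With the total fixed, the coordinate at `s` is determined by the others. Forgetting it embeds
the index set into a full cube, where the sum factors into geometric sums. -/
theorem sum_piAntidiag_prod_erase_le {d : ℕ} (q : ℝ) (hq : 0 ≤ q) (s : Fin d) (n : ℕ) :
    ∑ j ∈ Finset.piAntidiag (Finset.univ : Finset (Fin d)) n, ∏ t ∈ Finset.univ.erase s, q ^ j t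
      ≤ (∑ i ∈ Finset.range (n + 1), q ^ i) ^ (d - 1) := by
  have h0 : (Finset.univ.erase s).card = d - 1 := by simp
  rw [← h0, ← Finset.prod_const, Finset.prod_sum]
  have hinj : Set.InjOn (fun (j : Fin d → ℕ) (t : Fin d) (_ : t ∈ Finset.univ.erase s) => j t)
      (Finset.piAntidiag (Finset.univ : Finset (Fin d)) n) := by
    intro j hj j' hj' h
    have h1 : ∀ t ≠ s, j t = j' t := fun t ht =>
      congrFun (congrFun h t) (Finset.mem_erase.2 ⟨ht, Finset.mem_univ t⟩)
    have e1 : ∑ t, j t = n := (Finset.mem_piAntidiag.1 hj).1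
    have e2 : ∑ t, j' t = n := (Finset.mem_piAntidiag.1 hj').1
    rw [← Finset.add_sum_erase _ _ (Finset.mem_univ s)] at e1 e2
    have e3 : ∑ t ∈ Finset.univ.erase s, j t = ∑ t ∈ Finset.univ.erase s, j' t :=
      Finset.sum_congr rfl fun t ht => h1 t (Finset.mem_erase.1 ht).1
    funext t
    rcases eq_or_ne t s with rfl | ht
    · rw [e3] at e1
      exact Nat.add_right_cancel (e1.trans e2.symm)
    · exact h1 t ht
  calc ∑ j ∈ Finset.piAntidiag (Finset.univ : Finset (Fin d)) n,
        ∏ t ∈ Finset.univ.erase s, q ^ j t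
      = ∑ j ∈ Finset.piAntidiag (Finset.univ : Finset (Fin d)) n,
        ∏ x ∈ (Finset.univ.erase s).attach, q ^ j x.1 :=
        Finset.sum_congr rfl fun j _ => (Finset.prod_attach _ fun t => q ^ j t).symm
    _ = _ := (Finset.sum_image (f := fun p : (t : Fin d) → t ∈ Finset.univ.erase s → ℕ =>
        ∏ x ∈ (Finset.univ.erase s).attach, q ^ p x.1 x.2) hinj).symm
    _ ≤ _ := by
      refine Finset.sum_le_sum_of_subset_of_nonneg ?_ fun _ _ _ => by positivity
      intro p hp
      obtain ⟨j, hj, rfl⟩ := Finset.mem_image.1 hp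
      simp only [Finset.mem_pi, Finset.mem_range]
      intro t _
      have := Finset.single_le_sum (f := j) (fun i _ => Nat.zero_le _) (Finset.mem_univ t)
      have : ∑ t, j t = n := (Finset.mem_piAntidiag.1 hj).1
      omega

/-! ### Hybrid weights on dyadic blocks -/

theorem one_le_one_add_sum_sq {d : ℕ} (m : Fin d → ℤ) : (1 : ℝ) ≤ 1 + ∑ s, (m s : ℝ) ^ 2 :=
  le_add_of_nonneg_right (Finset.sum_nonneg fun _ _ => sq_nonneg _)

theorem one_add_sum_sq_le_prod {d : ℕ} (m : Fin d → ℤ) :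
    1 + ∑ s, (m s : ℝ) ^ 2 ≤ ∏ s, (1 + (m s : ℝ) ^ 2) :=
  by
  induction (Finset.univ : Finset (Fin d)) using Finset.cons_induction with
  | empty => simp
  | cons a t ha ih =>
    rw [Finset.sum_cons, Finset.prod_cons]
    have : 0 ≤ ∑ s ∈ t, (m s : ℝ) ^ 2 := Finset.sum_nonneg fun _ _ => sq_nonneg _
    nlinarith [mul_nonneg (sq_nonneg (m a : ℝ)) this, sq_nonneg (m a : ℝ), mul_le_mul_of_nonneg_left ih (sq_nonneg (m a : ℝ))]

theorem hybridWeight_eq {d : ℕ} (α β : ℝ) (m : Fin d → ℤ) :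
    hybridWeight α β m = (1 + ∑ s, (m s : ℝ) ^ 2) ^ β * (∏ s, (1 + (m s : ℝ) ^ 2)) ^ α := by
  rw [hybridWeight, Real.finsetProd_rpow _ _ fun _ _ => by positivity]

theorem hybridWeight_zero_left {d : ℕ} (γ : ℝ) (m : Fin d → ℤ) :
    hybridWeight 0 γ m = (1 + ∑ s, (m s : ℝ) ^ 2) ^ γ := by
  simp [hybridWeight]

theorem hybridWeight_pos {d : ℕ} (α β : ℝ) (m : Fin d → ℤ) : 0 < hybridWeight α β m := by
  unfold hybridWeight
  positivity

theorem four_pow_le_one_add_sq {d : ℕ} (m : Fin d → ℤ) (s : Fin d) :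
    (4 : ℝ) ^ dyadicIndex m s ≤ 4 * (1 + (m s : ℝ) ^ 2) := by
  rcases Nat.eq_zero_or_pos (dyadicIndex m s) with h | h
  · rw [h]
    nlinarith [sq_nonneg (m s : ℝ)]
  · have h2 : 2 ^ (dyadicIndex m s - 1) < |m s| := two_pow_lt_abs (by omega)
    have h3 : (2 : ℝ) ^ (dyadicIndex m s - 1) ≤ |(m s : ℝ)| := by exact_mod_cast h2.le
    have h4 : (4 : ℝ) ^ dyadicIndex m s = 4 * (2 ^ (dyadicIndex m s - 1)) ^ 2 := by
      rw [← pow_mul, mul_comm _ 2, pow_mul]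
      norm_num
      rw [← pow_succ', Nat.sub_add_cancel h]
    rw [h4, ← sq_abs (m s : ℝ)]
    have := pow_le_pow_left₀ (by positivity) h3 2
    linarith

theorem four_pow_sum_dyadicIndex_le {d : ℕ} (m : Fin d → ℤ) :
    (4 : ℝ) ^ (∑ s, dyadicIndex m s) ≤ 4 ^ d * ∏ s, (1 + (m s : ℝ) ^ 2) := by
  rw [← Finset.prod_pow_eq_pow_sum]
  refine (Finset.prod_le_prod (fun _ _ => by positivity)
    fun s _ => four_pow_le_one_add_sq m s).trans ?_
  simp [Finset.prod_mul_distrib]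

theorem sq_le_four_pow_dyadicIndex {d : ℕ} (m : Fin d → ℤ) (s : Fin d) :
    (m s : ℝ) ^ 2 ≤ 4 ^ dyadicIndex m s := by
  have h : |(m s : ℝ)| ≤ 2 ^ dyadicIndex m s := by
    exact_mod_cast abs_le_two_pow_dyadicIndex m s
  rw [← sq_abs]
  refine (pow_le_pow_left₀ (abs_nonneg _) h 2).trans_eq ?_
  rw [← pow_mul, mul_comm, pow_mul]
  norm_num

/-- The product part of the weight sees the total level, the isotropic part only the largest index.
Moving `4 ^ β` for the largest index into the total level leaves the decay `4 ^ β` in the remaining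
indices. Summing over all `s` makes the bound independent of which index is largest. -/
theorem inv_hybridWeight_le {d : ℕ} (hd : 1 ≤ d) {α β : ℝ} (hα : 0 ≤ α) (hβ : β ≤ 0)
    (m : Fin d → ℤ) :
    (hybridWeight α β m)⁻¹ ≤ ((d + 1 : ℝ) ^ (-β) * (4 : ℝ) ^ (α * d)) *
      (((4 : ℝ) ^ (-(α + β))) ^ (∑ s, dyadicIndex m s) *
        ∑ s, ∏ t ∈ Finset.univ.erase s, ((4 : ℝ) ^ β) ^ dyadicIndex m t) := by
  have : Nonempty (Fin d) := ⟨⟨0, hd⟩⟩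
  obtain ⟨s, -, hs⟩ := Finset.exists_max_image Finset.univ (dyadicIndex m) Finset.univ_nonempty
  have hn : ∑ s, dyadicIndex m s =
      dyadicIndex m s + ∑ t ∈ Finset.univ.erase s, dyadicIndex m t :=
    (Finset.add_sum_erase _ _ (Finset.mem_univ s)).symm
  have hx : 1 + ∑ s, (m s : ℝ) ^ 2 ≤ (d + 1 : ℝ) * 4 ^ dyadicIndex m s := by
    have h1 : ∑ t, (m t : ℝ) ^ 2 ≤ ∑ _t : Fin d, (4 : ℝ) ^ dyadicIndex m s :=
      Finset.sum_le_sum fun t ht => (sq_le_four_pow_dyadicIndex m t).trans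
        (pow_le_pow_right₀ (by norm_num) (hs t ht))
    have h2 : (1 : ℝ) ≤ 4 ^ dyadicIndex m s := one_le_pow₀ (by norm_num)
    simp only [Finset.sum_const, Finset.card_univ, Fintype.card_fin, nsmul_eq_mul] at h1
    linarith
  have hx0 := one_le_one_add_sum_sq m
  have hP := four_pow_sum_dyadicIndex_le m
  set P := ∏ s, (1 + (m s : ℝ) ^ 2) with hPdef
  have hP0 : 0 < P := Finset.prod_pos fun _ _ => by positivity
  have e1 : (1 + ∑ s, (m s : ℝ) ^ 2) ^ (-β) ≤
      (d + 1 : ℝ) ^ (-β) * ((4 : ℝ) ^ (-β)) ^ dyadicIndex m s := by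
    refine (Real.rpow_le_rpow (by positivity) hx (by linarith)).trans_eq ?_
    rw [Real.mul_rpow (by positivity) (by positivity), ← Real.rpow_natCast, ← Real.rpow_natCast,
      ← Real.rpow_mul (by norm_num), ← Real.rpow_mul (by norm_num), mul_comm (-β)]
  have e2 : P ^ (-α) ≤ (4 : ℝ) ^ (α * d) * ((4 : ℝ) ^ (-α)) ^ (∑ s, dyadicIndex m s) := by
    have h1 : (4 : ℝ) ^ (∑ s, dyadicIndex m s) * (4 ^ d)⁻¹ ≤ P := by
      rw [← div_eq_mul_inv, div_le_iff₀ (by positivity)]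
      linarith
    refine (Real.rpow_le_rpow_of_nonpos (by positivity) h1 (by linarith)).trans_eq ?_
    rw [Real.mul_rpow (by positivity) (by positivity), ← Real.rpow_natCast, ← Real.rpow_natCast,
      ← Real.rpow_natCast, ← Real.rpow_neg (by norm_num), ← Real.rpow_mul (by norm_num),
      ← Real.rpow_mul (by norm_num), ← Real.rpow_mul (by norm_num), mul_comm]
    congr 2 <;> ring
  have e3 : ((4 : ℝ) ^ (-β)) ^ dyadicIndex m s * ((4 : ℝ) ^ (-α)) ^ (∑ s, dyadicIndex m s) =
      ((4 : ℝ) ^ (-(α + β))) ^ (∑ s, dyadicIndex m s) *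
        ∏ t ∈ Finset.univ.erase s, ((4 : ℝ) ^ β) ^ dyadicIndex m t := by
    rw [Finset.prod_pow_eq_pow_sum, hn]
    simp only [← Real.rpow_natCast, ← Real.rpow_mul (show (0 : ℝ) ≤ 4 by norm_num),
      ← Real.rpow_add (show (0 : ℝ) < 4 by norm_num)]
    congr 1
    push_cast
    ring
  have e4 : ∏ t ∈ Finset.univ.erase s, ((4 : ℝ) ^ β) ^ dyadicIndex m t ≤
      ∑ s, ∏ t ∈ Finset.univ.erase s, ((4 : ℝ) ^ β) ^ dyadicIndex m t :=
    Finset.single_le_sum (f := fun s => ∏ t ∈ Finset.univ.erase s, ((4 : ℝ) ^ β) ^ dyadicIndex m t)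
      (fun _ _ => by positivity) (Finset.mem_univ s)
  rw [hybridWeight_eq, mul_inv, ← Real.rpow_neg (by positivity), ← Real.rpow_neg hP0.le]
  calc _ ≤ ((d + 1 : ℝ) ^ (-β) * ((4 : ℝ) ^ (-β)) ^ dyadicIndex m s) *
        ((4 : ℝ) ^ (α * d) * ((4 : ℝ) ^ (-α)) ^ (∑ s, dyadicIndex m s)) :=
        mul_le_mul e1 e2 (by positivity) (by positivity)
    _ = ((d + 1 : ℝ) ^ (-β) * (4 : ℝ) ^ (α * d)) * (((4 : ℝ) ^ (-β)) ^ dyadicIndex m s *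
        ((4 : ℝ) ^ (-α)) ^ (∑ s, dyadicIndex m s)) := by ring
    _ ≤ _ := by
      rw [e3]
      gcongr

/-! ### Inverse weights over separated sets -/

/-- The logarithmic factor `(T + 1) ^ (d - 1)`, which only occurs for `β = 0`. -/
noncomputable def logFactor (d : ℕ) (β : ℝ) (T : ℕ) : ℝ :=
  if β = 0 then ((T : ℝ) + 1) ^ (d - 1) else 1

theorem logFactor_pos (d : ℕ) (β : ℝ) (T : ℕ) : 0 < logFactor d β T := by
  unfold logFactor
  split_ifs <;> positivity

theorem logFactor_add_le (d : ℕ) (β : ℝ) (T i : ℕ) :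
    logFactor d β (T + i) ≤ logFactor d β T * ((i : ℝ) + 1) ^ (d - 1) := by
  unfold logFactor
  split_ifs
  · rw [← mul_pow]
    refine pow_le_pow_left₀ (by positivity) ?_ _
    push_cast
    nlinarith [mul_nonneg (Nat.cast_nonneg (α := ℝ) T) (Nat.cast_nonneg (α := ℝ) i)]
  · rw [one_mul]
    exact one_le_pow₀ (by simp)

theorem exists_geom_sum_pow_le (d : ℕ) {β : ℝ} (hβ : β ≤ 0) :
    ∃ C : ℝ, 0 < C ∧ ∀ n : ℕ,
      (∑ i ∈ Finset.range (n + 1), ((4 : ℝ) ^ β) ^ i) ^ (d - 1) ≤ C * logFactor d β n := by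
  rcases hβ.eq_or_lt with rfl | h
  · exact ⟨1, one_pos, fun n => by simp [logFactor]⟩
  · have hq : (4 : ℝ) ^ β < 1 := Real.rpow_lt_one_of_one_lt_of_neg (by norm_num) h
    have hq0 : (0 : ℝ) ≤ 4 ^ β := by positivity
    have h1 : 0 < (1 - (4 : ℝ) ^ β)⁻¹ := inv_pos.2 (by linarith)
    refine ⟨((1 - (4 : ℝ) ^ β)⁻¹) ^ (d - 1), by positivity, fun n => ?_⟩
    rw [logFactor, if_neg h.ne, mul_one]
    refine pow_le_pow_left₀ (by positivity) ?_ _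
    rw [← tsum_geometric_of_lt_one hq0 hq]
    exact (summable_geometric_of_lt_one hq0 hq).sum_le_tsum _ fun _ _ => by positivity

theorem summable_add_one_pow_mul_geometric (k : ℕ) {r : ℝ} (h0 : 0 < r) (h1 : r < 1) :
    Summable fun i : ℕ => ((i : ℝ) + 1) ^ k * r ^ i := by
  have h := (summable_nat_add_iff 1).2 (summable_pow_mul_geometric_of_norm_lt_one (R := ℝ) k
    (r := r) (by rwa [Real.norm_of_nonneg h0.le]))
  refine (h.mul_right r⁻¹).congr fun i => ?_
  push_cast
  rw [pow_succ]
  field_simp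

/-- Level `T + i` contributes `2 ^ i` points per block against an inverse weight of order `4 ^ (-(α
+ β) * (T + i))`. The constant is uniform in the separated set, which lets it serve all residue
classes at once. -/
theorem exists_sum_inv_hybridWeight_le {d : ℕ} (hd : 1 ≤ d) {α β : ℝ} (hβ : β ≤ 0)
    (hαβ : 1 / 2 < α + β) :
    ∃ C : ℝ, 0 < C ∧ ∀ (L : Set (Fin d → ℤ)) (T : ℕ), IsDyadicallySeparated L T →
      ∀ F : Finset (Fin d → ℤ), (∀ m ∈ F, m ∈ L) → (∀ m ∈ F, T ≤ ∑ s, dyadicIndex m s) →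
        ∑ m ∈ F, (hybridWeight α β m)⁻¹ ≤
          C * (((4 : ℝ) ^ (-(α + β))) ^ T * logFactor d β T) := by
  obtain ⟨C₁, hC₁, hgeom⟩ := exists_geom_sum_pow_le d hβ
  set C₀ : ℝ := (d + 1 : ℝ) ^ (-β) * (4 : ℝ) ^ (α * d) with hC₀
  have hC₀pos : 0 < C₀ := by positivity
  set p : ℝ := (4 : ℝ) ^ (-(α + β)) with hp
  have hp0 : 0 < p := by positivity
  -- This is where `α + β > 1/2` enters: `4 ^ (-1/2) = 1/2`.
  have hp1 : 2 * p < 1 := by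
    have : p < 4 ^ (-(1 / 2) : ℝ) := Real.rpow_lt_rpow_of_exponent_lt (by norm_num) (by linarith)
    rw [show (4 : ℝ) = 2 ^ (2 : ℝ) by norm_num, ← Real.rpow_mul (by norm_num)] at this
    norm_num [Real.rpow_neg_one] at this
    linarith
  have hsum := summable_add_one_pow_mul_geometric (d - 1) (r := 2 * p) (by positivity) hp1
  set S := ∑' i : ℕ, ((i : ℝ) + 1) ^ (d - 1) * (2 * p) ^ i with hS
  have hS0 : 0 ≤ S := tsum_nonneg fun _ => by positivity
  have hd0 : (0 : ℝ) < d := by exact_mod_cast hd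
  refine ⟨3 ^ d * C₀ * d * C₁ * (S + 1), by positivity, fun L T hL F hF hFT => ?_⟩
  have hlog := logFactor_pos d β T
  have block : ∀ i : ℕ, ∀ j ∈ Finset.piAntidiag (Finset.univ : Finset (Fin d)) (T + i),
      ∑ m ∈ F with dyadicIndex m = j, (hybridWeight α β m)⁻¹ ≤
        3 ^ d * C₀ * (2 ^ i * p ^ (T + i)) *
          ∑ s, ∏ t ∈ Finset.univ.erase s, ((4 : ℝ) ^ β) ^ j t := by
    intro i j hj
    have hj : ∑ s, j s = T + i := (Finset.mem_piAntidiag.1 hj).1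
    have hcard := hL.card_le (F := F.filter fun m => dyadicIndex m = j) (j := j)
      (fun m hm => hF m (Finset.mem_filter.1 hm).1)
      (fun m hm s => by
        rw [← (Finset.mem_filter.1 hm).2]
        exact abs_le_two_pow_dyadicIndex m s) (by omega)
    rw [hj, Nat.add_sub_cancel_left] at hcard
    have hcard' : ((F.filter fun m => dyadicIndex m = j).card : ℝ) ≤ 3 ^ d * 2 ^ i := by
      exact_mod_cast hcard
    refine (Finset.sum_le_card_nsmul _ _ (C₀ * (p ^ (T + i) *
      ∑ s, ∏ t ∈ Finset.univ.erase s, ((4 : ℝ) ^ β) ^ j t)) ?_).trans ?_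
    · intro m hm
      have hm := (Finset.mem_filter.1 hm).2
      have := inv_hybridWeight_le hd (α := α) (by linarith) hβ m
      rwa [hm, hj] at this
    · rw [nsmul_eq_mul]
      refine (mul_le_mul_of_nonneg_right hcard' (by positivity)).trans_eq ?_
      ring
  have level : ∀ i : ℕ, ∑ m ∈ F with ∑ s, dyadicIndex m s = T + i, (hybridWeight α β m)⁻¹ ≤
      3 ^ d * C₀ * d * C₁ * (p ^ T * logFactor d β T) *
        (((i : ℝ) + 1) ^ (d - 1) * (2 * p) ^ i) := by
    intro i
    have hmaps : ∀ m ∈ F.filter (fun m => ∑ s, dyadicIndex m s = T + i),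
        dyadicIndex m ∈ Finset.piAntidiag (Finset.univ : Finset (Fin d)) (T + i) := by
      intro m hm
      exact Finset.mem_piAntidiag.2 ⟨(Finset.mem_filter.1 hm).2, fun _ _ => Finset.mem_univ _⟩
    rw [← Finset.sum_fiberwise_of_maps_to hmaps]
    have h1 : ∀ j ∈ Finset.piAntidiag (Finset.univ : Finset (Fin d)) (T + i),
        ∑ m ∈ F.filter (fun m => ∑ s, dyadicIndex m s = T + i) with dyadicIndex m = j,
          (hybridWeight α β m)⁻¹ ≤ 3 ^ d * C₀ * (2 ^ i * p ^ (T + i)) *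
          ∑ s, ∏ t ∈ Finset.univ.erase s, ((4 : ℝ) ^ β) ^ j t := by
      intro j hj
      refine (Finset.sum_le_sum_of_subset_of_nonneg
        (Finset.filter_subset_filter _ (Finset.filter_subset _ _)) fun m _ _ =>
          (inv_pos.2 (hybridWeight_pos α β m)).le).trans (block i j hj)
    refine (Finset.sum_le_sum h1).trans ?_
    rw [← Finset.mul_sum, Finset.sum_comm]
    have h2 : ∑ s : Fin d, ∑ j ∈ Finset.piAntidiag (Finset.univ : Finset (Fin d)) (T + i),
        ∏ t ∈ Finset.univ.erase s, ((4 : ℝ) ^ β) ^ j t ≤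
          d * (C₁ * (logFactor d β T * ((i : ℝ) + 1) ^ (d - 1))) := by
      refine (Finset.sum_le_card_nsmul _ _ (C₁ * (logFactor d β T * ((i : ℝ) + 1) ^ (d - 1)))
        fun s _ => ?_).trans_eq ?_
      · refine (sum_piAntidiag_prod_erase_le _ (by positivity) s (T + i)).trans ?_
        refine (hgeom (T + i)).trans ?_
        gcongr
        exact logFactor_add_le d β T i
      · simp
    refine (mul_le_mul_of_nonneg_left h2 (by positivity)).trans_eq ?_
    rw [mul_pow, pow_add]
    ring
  -- Fibre over the excess level; the natural subtraction is exact because every level in `F` is at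
  -- least `T`.
  have hmaps : ∀ m ∈ F, (∑ s, dyadicIndex m s) - T ∈
      Finset.range (F.sup (fun m => ∑ s, dyadicIndex m s) + 1) := by
    intro m hm
    have := Finset.le_sup (f := fun m : Fin d → ℤ => ∑ s, dyadicIndex m s) hm
    simp only [Finset.mem_range]
    omega
  rw [← Finset.sum_fiberwise_of_maps_to hmaps]
  calc _ ≤ ∑ i ∈ Finset.range (F.sup (fun m => ∑ s, dyadicIndex m s) + 1),
      3 ^ d * C₀ * d * C₁ * (p ^ T * logFactor d β T) *
        (((i : ℝ) + 1) ^ (d - 1) * (2 * p) ^ i) := by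
        refine Finset.sum_le_sum fun i _ => (le_of_eq ?_).trans (level i)
        refine Finset.sum_congr (Finset.filter_congr fun m hm => ?_) fun _ _ => rfl
        have := hFT m hm
        omega
    _ ≤ 3 ^ d * C₀ * d * C₁ * (p ^ T * logFactor d β T) * S := by
        rw [← Finset.mul_sum]
        gcongr
        exact hsum.sum_le_tsum _ fun _ _ => by positivity
    _ ≤ 3 ^ d * C₀ * d * C₁ * (p ^ T * logFactor d β T) * (S + 1) := by
        gcongr
        linarith
    _ = _ := by ring

/-! ### Fourier coefficients and aliasing -/

open UnitAddTorus in
theorem mFourierCoeff_sub {d : ℕ} (f g : TorusL2 d) (k : Fin d → ℤ) :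
    mFourierCoeff (f - g : TorusL2 d) k = mFourierCoeff f k - mFourierCoeff g k := by
  have h := mFourierBasis_repr (d := Fin d)
  rw [← h f k, ← h g k, ← h (f - g) k, map_sub]
  rfl

open UnitAddTorus in
theorem mFourierCoeff_smul {d : ℕ} (c : ℂ) (f : TorusL2 d) (k : Fin d → ℤ) :
    mFourierCoeff (c • f : TorusL2 d) k = c * mFourierCoeff f k := by
  have h := mFourierBasis_repr (d := Fin d)
  rw [← h f k, ← h (c • f) k, map_smul]
  rfl

open UnitAddTorus in
theorem mFourierCoeff_finsetSum {d : ℕ} {ι : Type*} (t : Finset ι) (f : ι → TorusL2 d)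
    (k : Fin d → ℤ) :
    mFourierCoeff (∑ i ∈ t, f i : TorusL2 d) k = ∑ i ∈ t, mFourierCoeff (f i) k := by
  have h := mFourierBasis_repr (d := Fin d)
  rw [← h (∑ i ∈ t, f i) k, map_sum, lp.coeFn_sum, Finset.sum_apply]
  exact Finset.sum_congr rfl fun i _ => h (f i) k

open UnitAddTorus in
theorem mFourierCoeff_toLp_mFourier {d : ℕ} (n k : Fin d → ℤ) :
    mFourierCoeff (ContinuousMap.toLp 2 (torusMeasure d) ℂ (mFourier n)) k =
      if k = n then 1 else 0 := by
  have h := mFourierBasis_repr (d := Fin d) (mFourierLp 2 n) k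
  rw [← coe_mFourierBasis, HilbertBasis.repr_self, lp.single_apply] at h
  rw [coe_mFourierBasis] at h
  refine h.symm.trans ?_
  split_ifs with hk
  · subst hk
    simp
  · simp [hk]

/-- The residue `m · z` that determines the values of `exp(2πi m · ∘)` at the nodes of `Λ(z, M)`. -/
def latticeResidue {d : ℕ} (z m : Fin d → ℤ) : ℤ :=
  ∑ i, m i * z i

theorem mFourier_latticeNode {d : ℕ} (z : Fin d → ℤ) (M j : ℕ) (k : Fin d → ℤ) :
    UnitAddTorus.mFourier k (latticeNode z M j) =
      Complex.exp (2 * Real.pi * Complex.I * (latticeResidue z k) / M) ^ j := by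
  rw [← Complex.exp_nat_mul]
  simp only [UnitAddTorus.mFourier, ContinuousMap.coe_mk, latticeNode, fourier_coe_apply]
  rw [← Complex.exp_sum]
  congr 1
  rw [latticeResidue]
  push_cast
  rw [Finset.mul_sum, Finset.sum_div, Finset.mul_sum]
  refine Finset.sum_congr rfl fun i _ => ?_
  ring

/-- Orthogonality of the characters of `ℤ / M`: the nodes turn the exponential into powers of an
`M`-th root of unity, whose geometric sum vanishes unless that root is `1`. -/
theorem latticeCoeff_mFourier {d : ℕ} (z : Fin d → ℤ) {M : ℕ} (hM : 0 < M) (m k : Fin d → ℤ) :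
    latticeCoeff z M (UnitAddTorus.mFourier m) k =
      if latticeResidue z m ≡ latticeResidue z k [ZMOD M] then 1 else 0 := by
  have hM' : (M : ℂ) ≠ 0 := by exact_mod_cast hM.ne'
  have hres : latticeResidue z (m + -k) = latticeResidue z m - latticeResidue z k := by
    simp [latticeResidue, add_mul, Finset.sum_add_distrib, sub_eq_add_neg]
  unfold latticeCoeff
  simp only [← UnitAddTorus.mFourier_add]
  simp only [mFourier_latticeNode]
  rw [hres]
  set a : ℤ := latticeResidue z m - latticeResidue z k with ha
  split_ifs with h
  · obtain ⟨b, hb⟩ : (M : ℤ) ∣ a := h.symm.dvd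
    have h1 : Complex.exp (2 * Real.pi * Complex.I * a / M) = 1 := by
      rw [Complex.exp_eq_one_iff]
      refine ⟨b, ?_⟩
      rw [hb]
      push_cast
      field_simp
    simp [h1, hM']
  · have h1 : Complex.exp (2 * Real.pi * Complex.I * a / M) ≠ 1 := by
      intro h1
      obtain ⟨b, hb⟩ := Complex.exp_eq_one_iff.1 h1
      refine h (Int.modEq_iff_dvd.2 ⟨-b, ?_⟩)
      have h2 : (a : ℂ) = b * M := by
        have h3 : (2 * Real.pi * Complex.I : ℂ) ≠ 0 := Complex.two_pi_I_ne_zero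
        rw [div_eq_iff hM', mul_assoc (b : ℂ), mul_comm (2 * Real.pi * Complex.I : ℂ) (M : ℂ),
          ← mul_assoc, mul_comm] at hb
        exact mul_right_cancel₀ h3 hb
      have h3 : a = b * M := by exact_mod_cast h2
      linarith
    rw [geom_sum_eq h1, ← Complex.exp_nat_mul, mul_div_cancel₀ _ hM',
      Complex.exp_eq_one_iff.2 ⟨a, by ring⟩]
    simp

theorem mFourierCoeff_latticeSampling {d : ℕ} (z : Fin d → ℤ) (M : ℕ) (I : Finset (Fin d → ℤ))
    (g : C(UnitAddTorus (Fin d), ℂ)) (k : Fin d → ℤ) :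
    UnitAddTorus.mFourierCoeff
      (ContinuousMap.toLp 2 (torusMeasure d) ℂ (latticeSampling z M I g)) k =
        if k ∈ I then latticeCoeff z M g k else 0 := by
  rw [latticeSampling, map_sum, mFourierCoeff_finsetSum]
  simp only [map_smul, mFourierCoeff_smul, mFourierCoeff_toLp_mFourier]
  simp

/-- Otherwise sampling the exponential at `k` would also produce the one at `l`. -/
theorem IsReconstructing.eq_of_modEq {d : ℕ} {z : Fin d → ℤ} {M : ℕ} (hM : 0 < M)
    {I : Finset (Fin d → ℤ)} (h : IsReconstructing z M I) {k l : Fin d → ℤ} (hk : k ∈ I)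
    (hl : l ∈ I) (hkl : latticeResidue z k ≡ latticeResidue z l [ZMOD M]) : k = l := by
  have h1 := mFourierCoeff_latticeSampling z M I (UnitAddTorus.mFourier k) l
  rw [h _ (Submodule.subset_span ⟨k, hk, rfl⟩), mFourierCoeff_toLp_mFourier, if_pos hl,
    latticeCoeff_mFourier z hM, if_pos hkl] at h1
  by_contra hne
  rw [if_neg (Ne.symm hne)] at h1
  exact zero_ne_one h1

theorem continuousRep_spec {d : ℕ} {f : TorusL2 d}
    (hf : ∃ g : C(UnitAddTorus (Fin d), ℂ), ContinuousMap.toLp 2 (torusMeasure d) ℂ g = f) :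
    ContinuousMap.toLp 2 (torusMeasure d) ℂ (continuousRep f) = f := by
  rw [continuousRep, dif_pos hf]
  exact hf.choose_spec

theorem continuousRep_toLp {d : ℕ} (g : C(UnitAddTorus (Fin d), ℂ)) :
    continuousRep (ContinuousMap.toLp 2 (torusMeasure d) ℂ g) = g :=
  ContinuousMap.toLp_injective (torusMeasure d) (continuousRep_spec ⟨g, rfl⟩)

open UnitAddTorus in
theorem toLp_continuousRep {d : ℕ} {f : TorusL2 d} (hf : Summable (mFourierCoeff f)) :
    ContinuousMap.toLp 2 (torusMeasure d) ℂ (continuousRep f) = f := by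
  have h1 : Summable fun k => mFourierCoeff f k • (mFourier k : C(UnitAddTorus (Fin d), ℂ)) := by
    refine .of_norm ?_
    simpa only [norm_smul, mFourier_norm, mul_one] using hf.norm
  have h2 := h1.hasSum.mapL (ContinuousMap.toLp 2 (torusMeasure d) ℂ)
  have h3 := hasSum_mFourier_series_L2 (d := Fin d) f
  simp only [map_smul] at h2
  exact continuousRep_spec ⟨_, h2.unique h3⟩

open UnitAddTorus in
theorem hasSum_continuousRep_apply {d : ℕ} {f : TorusL2 d} (hf : Summable (mFourierCoeff f))
    (x : UnitAddTorus (Fin d)) :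
    HasSum (fun k => mFourierCoeff f k * mFourier k x) (continuousRep f x) := by
  have h1 : mFourierCoeff (continuousRep f) = mFourierCoeff f := by
    funext k
    rw [← mFourierCoeff_toLp]
    exact congrArg (fun g : TorusL2 d => mFourierCoeff g k) (toLp_continuousRep hf)
  have h2 := hasSum_mFourier_series_apply_of_summable (f := continuousRep f) (by rwa [h1]) x
  rwa [h1] at h2

-- Aliasing formula: the absolutely convergent Fourier series may be sampled term by term.
open UnitAddTorus in
theorem hasSum_latticeCoeff {d : ℕ} {f : TorusL2 d} (hf : Summable (mFourierCoeff f))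
    (z : Fin d → ℤ) {M : ℕ} (hM : 0 < M) (k : Fin d → ℤ) :
    HasSum (fun m => if latticeResidue z m ≡ latticeResidue z k [ZMOD M]
      then mFourierCoeff f m else 0) (latticeCoeff z M (continuousRep f) k) := by
  have h := (hasSum_sum fun j (_ : j ∈ Finset.range M) =>
    (hasSum_continuousRep_apply hf (latticeNode z M j)).mul_right
      (mFourier (-k) (latticeNode z M j))).mul_left (1 / (M : ℂ))
  refine h.congr_fun fun m => ?_
  have h1 := latticeCoeff_mFourier z hM m k
  rw [latticeCoeff] at h1
  rw [← mul_one (mFourierCoeff f m), ← mul_zero (mFourierCoeff f m), ← mul_ite, ← h1]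
  simp only [mul_one, Finset.mul_sum]
  refine Finset.sum_congr rfl fun j _ => by ring

/-- Cauchy–Schwarz on partial sums, then the limit. Only finite sums of `v` are controlled, which is
the form in which the inverse weight bound is available. -/
theorem norm_sq_le_of_hasSum {ι : Type*} {b : ι → ℂ} {B : ℂ} {u v : ι → ℝ} {K : ℝ}
    (hu : ∀ i, 0 ≤ u i) (hv : ∀ i, 0 ≤ v i) (hb : ∀ i, ‖b i‖ ^ 2 = u i * v i) (hB : HasSum b B)
    (hsum : Summable u) (hK : ∀ F : Finset ι, ∑ i ∈ F, v i ≤ K) : ‖B‖ ^ 2 ≤ (∑' i, u i) * K := by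
  refine le_of_tendsto ((hB.norm).pow 2) (Filter.Eventually.of_forall fun F => ?_)
  calc ‖∑ i ∈ F, b i‖ ^ 2 ≤ (∑ i ∈ F, ‖b i‖) ^ 2 :=
        pow_le_pow_left₀ (norm_nonneg _) (norm_sum_le _ _) 2
    _ ≤ (∑ i ∈ F, u i) * ∑ i ∈ F, v i :=
        Finset.sum_sq_le_sum_mul_sum_of_sq_le_mul F (fun i _ => hu i) (fun i _ => hv i)
          fun i _ => (hb i).le
    _ ≤ _ := mul_le_mul (hsum.sum_le_tsum F fun i _ => hu i) (hK F)
        (Finset.sum_nonneg fun i _ => hv i) (tsum_nonneg hu)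

/-! ### The upper bound -/

theorem IsReconstructing.isDyadicallySeparated {d : ℕ} (hd : 1 ≤ d) {R : ℝ} (hR : 0 ≤ R)
    {z : Fin d → ℤ} {M : ℕ} (hM : 0 < M) (h : IsReconstructing z M (hyperbolicCross d R))
    (k : Fin d → ℤ) :
    IsDyadicallySeparated {m | latticeResidue z m ≡ latticeResidue z k [ZMOD M]}
      (⌊R⌋₊ + (d - 1)) := by
  intro m hm m' hm' l hl hml
  have h1 : m - m' ∈ hyperbolicCross d R := by
    rw [mem_hyperbolicCross_iff hd hR]
    exact (Finset.sum_le_sum fun s _ => dyadicIndex_le_of_abs_le (hml s).le).trans hl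
  have h0 : (0 : Fin d → ℤ) ∈ hyperbolicCross d R := by
    rw [mem_hyperbolicCross_iff hd hR]
    simp [dyadicIndex]
  -- Both `m - m'` and `0` lie in the cross and have the same residue.
  refine sub_eq_zero.1 (h.eq_of_modEq hM h1 h0 ?_)
  have h2 : latticeResidue z (m - m') = latticeResidue z m - latticeResidue z m' := by
    simp [latticeResidue, sub_mul, Finset.sum_sub_distrib]
  have h3 : latticeResidue z (0 : Fin d → ℤ) = 0 := by simp [latticeResidue]
  rw [h2, h3, ← sub_self (latticeResidue z k)]
  exact Int.ModEq.sub hm hm'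

theorem summable_of_hybridNorm_le_one {d : ℕ} {α β : ℝ} {f : TorusL2 d}
    (hf : hybridNorm α β f ≤ 1) :
    (Summable fun k => ‖UnitAddTorus.mFourierCoeff f k‖ ^ 2 * hybridWeight α β k) ∧
      ∑' k, ‖UnitAddTorus.mFourierCoeff f k‖ ^ 2 * hybridWeight α β k ≤ 1 := by
  have h0 : ∀ k, 0 ≤ ‖UnitAddTorus.mFourierCoeff f k‖ ^ 2 * hybridWeight α β k :=
    fun k => mul_nonneg (sq_nonneg _) (hybridWeight_pos α β k).le
  have h1 : ∑' k, ENNReal.ofReal (‖UnitAddTorus.mFourierCoeff f k‖ ^ 2 * hybridWeight α β k) ≤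
      ENNReal.ofReal 1 := by
    rw [ENNReal.ofReal_one]
    by_contra hlt
    exact absurd hf (not_le.2 (ENNReal.one_lt_rpow (not_le.1 hlt) (by norm_num)))
  have h2 : Summable fun k => ‖UnitAddTorus.mFourierCoeff f k‖ ^ 2 * hybridWeight α β k := by
    have := ENNReal.summable_toReal (h1.trans_lt ENNReal.ofReal_lt_top).ne
    exact this.congr fun k => ENNReal.toReal_ofReal (h0 k)
  refine ⟨h2, ?_⟩
  rw [← ENNReal.ofReal_tsum_of_nonneg h0 h2] at h1
  exact (ENNReal.ofReal_le_ofReal_iff zero_le_one).1 h1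

theorem hybridNorm_le_of_tsum_le {d : ℕ} {γ : ℝ} {f : TorusL2 d} {b : (Fin d → ℤ) → ℝ} {B : ℝ}
    (hb : ∀ k, ‖UnitAddTorus.mFourierCoeff f k‖ ^ 2 * hybridWeight 0 γ k ≤ b k)
    (hsum : Summable b) (hB : ∑' k, b k ≤ B) :
    hybridNorm 0 γ f ≤ ENNReal.ofReal (B ^ (1 / 2 : ℝ)) := by
  have h0 : ∀ k, 0 ≤ b k := fun k =>
    (mul_nonneg (sq_nonneg _) (hybridWeight_pos 0 γ k).le).trans (hb k)
  have hB0 : 0 ≤ B := (tsum_nonneg h0).trans hB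
  rw [hybridNorm, ← ENNReal.ofReal_rpow_of_nonneg hB0 (by norm_num)]
  refine ENNReal.rpow_le_rpow ?_ (by norm_num)
  calc _ ≤ ∑' k, ENNReal.ofReal (b k) :=
        ENNReal.tsum_le_tsum fun k => ENNReal.ofReal_le_ofReal (hb k)
    _ = ENNReal.ofReal (∑' k, b k) := (ENNReal.ofReal_tsum_of_nonneg h0 hsum).symm
    _ ≤ _ := ENNReal.ofReal_le_ofReal hB

/-- The whole frequency lattice is separated at level `0`, so the bound for separated sets already
contains this. -/
theorem summable_inv_hybridWeight {d : ℕ} (hd : 1 ≤ d) {α β : ℝ} (hβ : β ≤ 0)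
    (hαβ : 1 / 2 < α + β) : Summable fun m : Fin d → ℤ => (hybridWeight α β m)⁻¹ := by
  obtain ⟨C, -, hC⟩ := exists_sum_inv_hybridWeight_le hd hβ hαβ
  exact summable_of_sum_le (fun m => (inv_pos.2 (hybridWeight_pos α β m)).le) fun F =>
    hC _ 0 isDyadicallySeparated_univ F (fun _ _ => Set.mem_univ _) fun _ _ => Nat.zero_le _

theorem summable_mFourierCoeff {d : ℕ} (hd : 1 ≤ d) {α β : ℝ} (hβ : β ≤ 0)
    (hαβ : 1 / 2 < α + β) {f : TorusL2 d} (hf : hybridNorm α β f ≤ 1) :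
    Summable (UnitAddTorus.mFourierCoeff f) := by
  refine .of_norm (.of_nonneg_of_le (fun _ => norm_nonneg _) (fun k => ?_)
    ((summable_of_hybridNorm_le_one hf).1.add (summable_inv_hybridWeight hd hβ hαβ)))
  have hw := hybridWeight_pos α β k
  set x := ‖UnitAddTorus.mFourierCoeff f k‖
  set w := hybridWeight α β k
  -- Sum-of-squares certificate for `x ≤ x ^ 2 * w + w⁻¹`, which dominates the coefficients by two
  -- summable families.
  have h1 : 0 ≤ (x * w - 1) ^ 2 + x ^ 2 * w ^ 2 + 1 := by positivity
  have h2 : x ^ 2 * w + w⁻¹ - x = ((x * w - 1) ^ 2 + x ^ 2 * w ^ 2 + 1) * (w⁻¹ / 2) := by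
    field_simp
    ring
  have h3 : 0 ≤ ((x * w - 1) ^ 2 + x ^ 2 * w ^ 2 + 1) * (w⁻¹ / 2) := by positivity
  linarith

/-- Split `γ = β + (γ - β)` in the isotropic factor and bound the second power by the product `P`. A
surplus `P ^ (α + β - γ)` remains, and it is large at level `T` and beyond. -/
theorem hybridWeight_zero_le_of_le_sum {d : ℕ} {α β γ : ℝ} (hβγ : β ≤ γ) (hδ : γ < α + β)
    {m : Fin d → ℤ} {T : ℕ} (hm : T ≤ ∑ s, dyadicIndex m s) :
    hybridWeight 0 γ m ≤ ((4 : ℝ) ^ (α + β - γ)) ^ d * ((4 : ℝ) ^ (-(α + β - γ))) ^ T *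
      hybridWeight α β m := by
  have hx0 := one_le_one_add_sum_sq m
  have hxP := one_add_sum_sq_le_prod m
  have hP := (pow_le_pow_right₀ (by norm_num : (1 : ℝ) ≤ 4) hm).trans
    (four_pow_sum_dyadicIndex_le m)
  rw [hybridWeight_zero_left, hybridWeight_eq]
  set x := 1 + ∑ s, (m s : ℝ) ^ 2
  set P := ∏ s, (1 + (m s : ℝ) ^ 2)
  have hx : 0 < x := by linarith
  have hP0 : 0 < P := by linarith
  have h1 : ((4 : ℝ) ^ (α + β - γ)) ^ T ≤ ((4 : ℝ) ^ (α + β - γ)) ^ d * P ^ (α + β - γ) := by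
    have h := Real.rpow_le_rpow (by positivity) hP (show 0 ≤ α + β - γ by linarith)
    rw [Real.mul_rpow (by positivity) hP0.le] at h
    rwa [← Real.rpow_pow_comm (by norm_num), ← Real.rpow_pow_comm (by norm_num)] at h
  have h2 : x ^ γ ≤ x ^ β * P ^ (γ - β) := by
    rw [show γ = β + (γ - β) by ring, Real.rpow_add hx, show β + (γ - β) - β = γ - β by ring]
    exact mul_le_mul_of_nonneg_left (Real.rpow_le_rpow hx.le hxP (by linarith)) (by positivity)
  have h3 : P ^ α = P ^ (γ - β) * P ^ (α + β - γ) := by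
    rw [← Real.rpow_add hP0]
    congr 1
    ring
  have h4 : ((4 : ℝ) ^ (-(α + β - γ))) ^ T * ((4 : ℝ) ^ (α + β - γ)) ^ T = 1 := by
    rw [← mul_pow, ← Real.rpow_add (by norm_num)]
    simp
  calc x ^ γ ≤ (x ^ β * P ^ (γ - β)) *
        (((4 : ℝ) ^ (-(α + β - γ))) ^ T * ((4 : ℝ) ^ (α + β - γ)) ^ T) := by rwa [h4, mul_one]
    _ ≤ (x ^ β * P ^ (γ - β)) * (((4 : ℝ) ^ (-(α + β - γ))) ^ T *
        (((4 : ℝ) ^ (α + β - γ)) ^ d * P ^ (α + β - γ))) := by gcongr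
    _ = _ := by rw [h3]; ring

theorem hybridWeight_zero_le_of_sum_le {d : ℕ} {γ : ℝ} (hγ : 0 ≤ γ) {m : Fin d → ℤ} {T : ℕ}
    (hm : ∑ s, dyadicIndex m s ≤ T) :
    hybridWeight 0 γ m ≤ ((2 : ℝ) ^ γ) ^ d * ((4 : ℝ) ^ γ) ^ T := by
  have hx0 := one_le_one_add_sum_sq m
  have h1 : ∏ s, (1 + (m s : ℝ) ^ 2) ≤ 2 ^ d * 4 ^ T := by
    calc ∏ s, (1 + (m s : ℝ) ^ 2) ≤ ∏ s, (2 * (4 : ℝ) ^ dyadicIndex m s) := by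
          refine Finset.prod_le_prod (fun _ _ => by positivity) fun s _ => ?_
          have h1 := sq_le_four_pow_dyadicIndex m s
          have h2 : (1 : ℝ) ≤ 4 ^ dyadicIndex m s := one_le_pow₀ (by norm_num)
          linarith
      _ = 2 ^ d * 4 ^ (∑ s, dyadicIndex m s) := by
          rw [Finset.prod_mul_distrib, Finset.prod_pow_eq_pow_sum]
          simp
      _ ≤ _ := by
          gcongr
          norm_num
  rw [hybridWeight_zero_left]
  refine (Real.rpow_le_rpow (by linarith) ((one_add_sum_sq_le_prod m).trans h1) hγ).trans_eq ?_
  rw [Real.mul_rpow (by positivity) (by positivity), ← Real.rpow_natCast, ← Real.rpow_natCast,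
    ← Real.rpow_natCast, ← Real.rpow_natCast, ← Real.rpow_mul (by norm_num),
    ← Real.rpow_mul (by norm_num), ← Real.rpow_mul (by norm_num), ← Real.rpow_mul (by norm_num),
    mul_comm γ, mul_comm γ]

/-- The aliasing part of the error at a frequency `k ∈ I`. -/
theorem norm_sq_sub_latticeCoeff_le {d : ℕ} {f : TorusL2 d} {α β K : ℝ} {z : Fin d → ℤ} {M : ℕ}
    (hM : 0 < M) (hs : Summable (UnitAddTorus.mFourierCoeff f))
    (hw : Summable fun k => ‖UnitAddTorus.mFourierCoeff f k‖ ^ 2 * hybridWeight α β k)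
    {k : Fin d → ℤ}
    (hK : ∀ F : Finset (Fin d → ℤ),
      (∀ m ∈ F, latticeResidue z m ≡ latticeResidue z k [ZMOD M] ∧ m ≠ k) →
        ∑ m ∈ F, (hybridWeight α β m)⁻¹ ≤ K) :
    ‖UnitAddTorus.mFourierCoeff f k - latticeCoeff z M (continuousRep f) k‖ ^ 2 ≤
      (∑' m, if latticeResidue z m ≡ latticeResidue z k [ZMOD M]
        then ‖UnitAddTorus.mFourierCoeff f m‖ ^ 2 * hybridWeight α β m else 0) * K := by
  classical
  have h0 : ∀ m, 0 ≤ ‖UnitAddTorus.mFourierCoeff f m‖ ^ 2 * hybridWeight α β m :=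
    fun m => mul_nonneg (sq_nonneg _) (hybridWeight_pos α β m).le
  -- Removing the term at `k` leaves exactly the aliased frequencies.
  have hB := (hasSum_latticeCoeff hs z hM k).sub
    (hasSum_ite_eq k (UnitAddTorus.mFourierCoeff f k))
  rw [norm_sub_rev]
  refine norm_sq_le_of_hasSum (v := fun m => if latticeResidue z m ≡ latticeResidue z k [ZMOD M] ∧
    m ≠ k then (hybridWeight α β m)⁻¹ else 0) ?_ ?_ ?_ hB ?_ ?_
  · intro m
    split_ifs
    exacts [h0 m, le_rfl]
  · intro m
    split_ifs
    exacts [(inv_pos.2 (hybridWeight_pos α β m)).le, le_rfl]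
  · intro m
    rcases eq_or_ne m k with rfl | hmk
    · simp
    · by_cases hm : latticeResidue z m ≡ latticeResidue z k [ZMOD M]
      · simp only [hm, hmk, if_true, if_false, sub_zero, ne_eq, not_false_eq_true, and_self]
        rw [mul_assoc, mul_inv_cancel₀ (hybridWeight_pos α β m).ne', mul_one]
      · simp [hm, hmk]
  · refine hw.of_nonneg_of_le (fun m => ?_) fun m => ?_
    · split_ifs
      exacts [h0 m, le_rfl]
    · split_ifs
      exacts [le_rfl, h0 m]
  · intro F
    rw [← Finset.sum_filter]
    exact hK _ fun m hm => (Finset.mem_filter.1 hm).2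

/-- Each frequency is counted at most once, since its residue is shared by at most one `k ∈ I`. -/
theorem sum_tsum_residueClass_le {d : ℕ} {z : Fin d → ℤ} {M : ℕ} {I : Finset (Fin d → ℤ)}
    (hI : ∀ k ∈ I, ∀ l ∈ I, latticeResidue z k ≡ latticeResidue z l [ZMOD M] → k = l)
    {a : (Fin d → ℤ) → ℝ} (h0 : ∀ m, 0 ≤ a m) (ha : Summable a) :
    ∑ k ∈ I, (∑' m, if latticeResidue z m ≡ latticeResidue z k [ZMOD M] then a m else 0) ≤
      ∑' m, a m := by
  have hs : ∀ k ∈ I, Summable fun m =>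
      if latticeResidue z m ≡ latticeResidue z k [ZMOD M] then a m else 0 := by
    intro k _
    refine ha.of_nonneg_of_le (fun m => ?_) fun m => ?_
    · split_ifs
      exacts [h0 m, le_rfl]
    · split_ifs
      exacts [le_rfl, h0 m]
  rw [← Summable.tsum_finsetSum hs]
  refine (summable_sum hs).tsum_le_tsum (fun m => ?_) ha
  rw [← Finset.sum_filter, Finset.sum_const, nsmul_eq_mul]
  refine mul_le_of_le_one_left (h0 m) ?_
  have : (I.filter fun k => latticeResidue z m ≡ latticeResidue z k [ZMOD M]).card ≤ 1 := by
    refine Finset.card_le_one.2 fun k hk l hl => ?_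
    rw [Finset.mem_filter] at hk hl
    exact hI k hk.1 l hl.1 (hk.2.symm.trans hl.2)
  exact_mod_cast this

theorem exists_samplingErrorNorm_le {d : ℕ} (hd : 1 ≤ d) {α β γ : ℝ} (hβ : β ≤ 0) (hγ : 0 ≤ γ)
    (hαβ : 1 / 2 < α + β) (hδ : γ < α + β) :
    ∃ C : ℝ, 0 < C ∧ ∀ R : ℝ, 0 ≤ R → ∀ (z : Fin d → ℤ) (M : ℕ), 0 < M →
      IsReconstructing z M (hyperbolicCross d R) →
        samplingErrorNorm α β γ z M (hyperbolicCross d R) ≤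
          ENNReal.ofReal ((C * (((4 : ℝ) ^ (-(α + β - γ))) ^ (⌊R⌋₊ + (d - 1)) *
            logFactor d β (⌊R⌋₊ + (d - 1)))) ^ (1 / 2 : ℝ)) := by
  obtain ⟨C, hC, hsum⟩ := exists_sum_inv_hybridWeight_le hd hβ hαβ
  refine ⟨((4 : ℝ) ^ (α + β - γ)) ^ d + ((2 : ℝ) ^ γ) ^ d * C, by positivity,
    fun R hR z M hM hrec => iSup_le fun ⟨f, hf⟩ => ?_⟩
  set T := ⌊R⌋₊ + (d - 1)
  obtain ⟨hw, hw1⟩ := summable_of_hybridNorm_le_one hf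
  have hs := summable_mFourierCoeff hd hβ hαβ hf
  have hmem : ∀ k, k ∈ hyperbolicCross d R ↔ ∑ s, dyadicIndex k s ≤ T :=
    fun k => mem_hyperbolicCross_iff hd hR
  have hinj : ∀ k ∈ hyperbolicCross d R, ∀ l ∈ hyperbolicCross d R,
      latticeResidue z k ≡ latticeResidue z l [ZMOD M] → k = l :=
    fun k hk l hl h => hrec.eq_of_modEq hM hk hl h
  set a : (Fin d → ℤ) → ℝ := fun k => ‖UnitAddTorus.mFourierCoeff f k‖ ^ 2 * hybridWeight α β k
    with ha
  have h0 : ∀ k, 0 ≤ a k := fun k => mul_nonneg (sq_nonneg _) (hybridWeight_pos α β k).le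
  set A : (Fin d → ℤ) → ℝ := fun k =>
    ∑' m, if latticeResidue z m ≡ latticeResidue z k [ZMOD M] then a m else 0 with hA
  -- `D` bounds the truncation. For aliasing, `X` bounds the target weight on the cross and `K` the
  -- inverse weights of the aliases; `X * K` has the same rate as `D`, up to the logarithmic factor.
  set D : ℝ := ((4 : ℝ) ^ (α + β - γ)) ^ d * ((4 : ℝ) ^ (-(α + β - γ))) ^ T with hD
  set K : ℝ := C * (((4 : ℝ) ^ (-(α + β))) ^ T * logFactor d β T) with hK
  set X : ℝ := ((2 : ℝ) ^ γ) ^ d * ((4 : ℝ) ^ γ) ^ T with hX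
  have hlog := logFactor_pos d β T
  have hlog1 : 1 ≤ logFactor d β T := by
    unfold logFactor
    split_ifs
    exacts [one_le_pow₀ (by simp), le_rfl]
  have hA0 : ∀ k, 0 ≤ A k := fun k => tsum_nonneg fun m => by
    split_ifs
    exacts [h0 m, le_rfl]
  have hfin : Summable fun k => if k ∈ hyperbolicCross d R then X * K * A k else 0 :=
    summable_of_ne_finset_zero (s := hyperbolicCross d R) fun k hk => if_neg hk
  refine hybridNorm_le_of_tsum_le
    (b := fun k => D * a k + if k ∈ hyperbolicCross d R then X * K * A k else 0) (fun k => ?_)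
    ((hw.mul_left D).add hfin) ?_
  · rw [mFourierCoeff_sub, mFourierCoeff_latticeSampling]
    split_ifs with hk
    · refine le_add_of_nonneg_of_le (mul_nonneg (by positivity) (h0 k)) ?_
      -- An alias of `k` inside the cross would equal `k`, so all proper aliases have level above
      -- `T`.
      have h1 := norm_sq_sub_latticeCoeff_le (f := f) (α := α) (β := β) (K := K) (z := z) hM hs hw
        (k := k) (fun F hF => hsum _ T (hrec.isDyadicallySeparated hd hR hM k) F
          (fun m hm => (hF m hm).1) fun m hm => by
            by_contra hlt
            exact (hF m hm).2 (hinj m ((hmem m).2 (by omega)) k hk (hF m hm).1))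
      have h2 := hybridWeight_zero_le_of_sum_le hγ ((hmem k).1 hk)
      refine (mul_le_mul h1 h2 (hybridWeight_pos _ _ _).le ?_).trans_eq ?_
      · exact mul_nonneg (hA0 k) (by positivity)
      · simp only [hA, ha, hX]
        ring
    · rw [sub_zero, add_zero]
      have h2 := hybridWeight_zero_le_of_le_sum (α := α) (hβ.trans hγ) hδ (m := k) (T := T)
        (by have := (hmem k).not.1 hk; omega)
      refine (mul_le_mul_of_nonneg_left h2 (sq_nonneg _)).trans_eq ?_
      simp only [ha, hD]
      ring
  · rw [(hw.mul_left D).tsum_add hfin, tsum_mul_left,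
      tsum_eq_sum (s := hyperbolicCross d R) fun k hk => if_neg hk,
      Finset.sum_congr rfl fun k hk => if_pos hk, ← Finset.mul_sum]
    have h1 := sum_tsum_residueClass_le hinj h0 hw
    have h2 : X * K = ((2 : ℝ) ^ γ) ^ d * C *
        (((4 : ℝ) ^ (-(α + β - γ))) ^ T * logFactor d β T) := by
      have : (4 : ℝ) ^ (-(α + β - γ)) = 4 ^ γ * 4 ^ (-(α + β)) := by
        rw [← Real.rpow_add (by norm_num)]
        congr 1
        ring
      rw [hX, hK, this, mul_pow]
      ring
    have h3 : D ≤ ((4 : ℝ) ^ (α + β - γ)) ^ d *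
        (((4 : ℝ) ^ (-(α + β - γ))) ^ T * logFactor d β T) := by
      rw [hD]
      gcongr
      exact le_mul_of_one_le_right (by positivity) hlog1
    have h4 : D * ∑' k, a k ≤ D * 1 := mul_le_mul_of_nonneg_left hw1 (by positivity)
    have h5 : X * K * ∑ k ∈ hyperbolicCross d R, A k ≤ X * K * 1 :=
      mul_le_mul_of_nonneg_left (h1.trans hw1) (by positivity)
    rw [add_mul]
    linarith

/-! ### The lower bound -/

/-- The normalised difference of the two exponentials vanishes at all nodes, so it is its own error;
the bound keeps only its coefficient at `k`. -/
theorem le_samplingErrorNorm_of_modEq {d : ℕ} (α β γ : ℝ) (z : Fin d → ℤ) {M : ℕ} (hM : 0 < M)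
    (I : Finset (Fin d → ℤ)) {k k' : Fin d → ℤ} (hne : k ≠ k')
    (hmod : latticeResidue z k ≡ latticeResidue z k' [ZMOD M]) :
    ENNReal.ofReal ((hybridWeight 0 γ k / (hybridWeight α β k + hybridWeight α β k')) ^
      (1 / 2 : ℝ)) ≤ samplingErrorNorm α β γ z M I := by
  have hw := hybridWeight_pos α β k
  have hw' := hybridWeight_pos α β k'
  have hwγ := hybridWeight_pos 0 γ k
  set r : ℝ := √(hybridWeight α β k + hybridWeight α β k')⁻¹ with hr
  have hr2 : r ^ 2 = (hybridWeight α β k + hybridWeight α β k')⁻¹ :=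
    Real.sq_sqrt (by positivity)
  set g : C(UnitAddTorus (Fin d), ℂ) :=
    (r : ℂ) • (UnitAddTorus.mFourier k - UnitAddTorus.mFourier k') with hg
  set f : TorusL2 d := ContinuousMap.toLp 2 (torusMeasure d) ℂ g with hf
  have hcoef : ∀ m, UnitAddTorus.mFourierCoeff f m =
      r * ((if m = k then 1 else 0) - (if m = k' then 1 else 0)) := by
    intro m
    rw [hf, hg, map_smul, map_sub, mFourierCoeff_smul, mFourierCoeff_sub,
      mFourierCoeff_toLp_mFourier, mFourierCoeff_toLp_mFourier]
  have hk : ‖UnitAddTorus.mFourierCoeff f k‖ ^ 2 = r ^ 2 := by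
    simp [hcoef, hne]
  have hk' : ‖UnitAddTorus.mFourierCoeff f k'‖ ^ 2 = r ^ 2 := by
    simp [hcoef, hne.symm]
  have hnorm : hybridNorm α β f ≤ 1 := by
    have h1 : ∑' m, ENNReal.ofReal (‖UnitAddTorus.mFourierCoeff f m‖ ^ 2 * hybridWeight α β m)
        = 1 := by
      rw [tsum_eq_sum (s := {k, k'}), Finset.sum_pair hne, hk, hk',
        ← ENNReal.ofReal_add (by positivity) (by positivity), ← mul_add, hr2,
        inv_mul_cancel₀ (by positivity), ENNReal.ofReal_one]
      intro m hm
      simp only [Finset.mem_insert, Finset.mem_singleton, not_or] at hm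
      simp [hcoef, hm.1, hm.2]
    rw [hybridNorm, h1, ENNReal.one_rpow]
  have hsamp : latticeSampling z M I (continuousRep f) = 0 := by
    rw [hf, continuousRep_toLp, latticeSampling]
    refine Finset.sum_eq_zero fun l _ => ?_
    have h1 : latticeCoeff z M g l = r * (latticeCoeff z M (UnitAddTorus.mFourier k) l -
        latticeCoeff z M (UnitAddTorus.mFourier k') l) := by
      simp only [latticeCoeff, hg, ContinuousMap.smul_apply, ContinuousMap.sub_apply, smul_eq_mul]
      rw [← mul_sub, ← Finset.sum_sub_distrib, mul_left_comm]
      congr 1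
      rw [Finset.mul_sum]
      exact Finset.sum_congr rfl fun j _ => by ring
    have h2 : latticeResidue z k ≡ latticeResidue z l [ZMOD M] ↔
        latticeResidue z k' ≡ latticeResidue z l [ZMOD M] :=
      ⟨fun h => hmod.symm.trans h, fun h => hmod.trans h⟩
    rw [h1, latticeCoeff_mFourier z hM, latticeCoeff_mFourier z hM, if_congr h2 rfl rfl, sub_self,
      mul_zero]
    exact ContinuousMap.ext fun x => zero_mul _
  refine le_trans ?_ (le_iSup (fun f : {f : TorusL2 d // hybridNorm α β f ≤ 1} =>
    hybridNorm 0 γ (f.1 - ContinuousMap.toLp 2 (torusMeasure d) ℂ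
      (latticeSampling z M I (continuousRep f.1)))) ⟨f, hnorm⟩)
  simp only [hsamp, map_zero, sub_zero]
  rw [hybridNorm, ← ENNReal.ofReal_rpow_of_nonneg (by positivity) (by norm_num)]
  refine ENNReal.rpow_le_rpow (le_trans (le_of_eq ?_) (ENNReal.le_tsum k)) (by norm_num)
  rw [hk, hr2, div_eq_inv_mul]

theorem hybridWeight_single {d : ℕ} (α β : ℝ) (i : Fin d) (v : ℤ) :
    hybridWeight α β (Pi.single i v) = (1 + (v : ℝ) ^ 2) ^ (α + β) := by
  have h1 : ∑ s, ((Pi.single i v : Fin d → ℤ) s : ℝ) ^ 2 = (v : ℝ) ^ 2 := by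
    rw [Finset.sum_eq_single i]
    · simp
    · intro s _ hs
      simp [hs]
    · simp
  have h2 : ∏ s, (1 + ((Pi.single i v : Fin d → ℤ) s : ℝ) ^ 2) = 1 + (v : ℝ) ^ 2 := by
    rw [Finset.prod_eq_single i]
    · simp
    · intro s _ hs
      simp [hs]
    · simp
  rw [hybridWeight_eq, h1, h2, ← Real.rpow_add (by positivity), add_comm β]

theorem latticeResidue_single {d : ℕ} (z : Fin d → ℤ) (i : Fin d) (v : ℤ) :
    latticeResidue z (Pi.single i v) = v * z i := by
  rw [latticeResidue, Finset.sum_eq_single i]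
  · simp
  · intro s _ hs
    simp [hs]
  · simp

/-- Pigeonhole: the pairs with entries up to `⌊√M⌋` outnumber the `M` residues, and the difference
of two colliding pairs is the relation. -/
theorem exists_small_relation (M : ℕ) (hM : 0 < M) (x y : ℤ) :
    ∃ a b : ℤ, (a ≠ 0 ∨ b ≠ 0) ∧ a ^ 2 ≤ M ∧ b ^ 2 ≤ M ∧ a * x ≡ b * y [ZMOD M] := by
  have : NeZero M := ⟨hM.ne'⟩
  set N := Nat.sqrt M
  have hN : N * N ≤ M := Nat.sqrt_le M
  obtain ⟨p, hp, q, hq, hpq, h⟩ := Finset.exists_ne_map_eq_of_card_lt_of_maps_to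
    (s := Finset.range (N + 1) ×ˢ Finset.range (N + 1)) (t := (Finset.univ : Finset (ZMod M)))
    (by
      rw [Finset.card_product, Finset.card_range, Finset.card_univ, ZMod.card]
      exact Nat.sqrt_lt'.1 (Nat.lt_succ_self N) |>.trans_eq (sq _))
    (f := fun p => (((p.1 : ℤ) * x + (p.2 : ℤ) * y : ℤ) : ZMod M))
    (fun _ _ => Finset.mem_coe.2 (Finset.mem_univ _))
  simp only [Finset.mem_product, Finset.mem_range] at hp hq
  have hsq : ∀ u v : ℕ, u < N + 1 → v < N + 1 → ((u : ℤ) - v) ^ 2 ≤ M := by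
    intro u v hu hv
    have h1 : |(u : ℤ) - v| ≤ N := by
      rw [abs_le]
      omega
    have h2 : ((u : ℤ) - v) ^ 2 ≤ (N : ℤ) ^ 2 := sq_le_sq' (abs_le.1 h1).1 (abs_le.1 h1).2
    have h3 : (N : ℤ) * N ≤ M := by exact_mod_cast hN
    rw [sq (N : ℤ)] at h2
    exact h2.trans h3
  refine ⟨p.1 - q.1, q.2 - p.2, ?_, hsq _ _ hp.1 hq.1, hsq _ _ hq.2 hp.2, ?_⟩
  · by_contra! hcon
    exact hpq (Prod.ext (by omega) (by omega))
  · rw [Int.modEq_iff_dvd]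
    have h2 := Int.modEq_iff_dvd.1 ((ZMod.intCast_eq_intCast_iff _ _ M).1 h)
    convert h2 using 1
    ring

theorem le_samplingErrorNorm {d : ℕ} (hd : 2 ≤ d) {α β γ : ℝ} (hαβ : 0 ≤ α + β)
    (hδ : γ < α + β) (z : Fin d → ℤ) {M : ℕ} (hM : 0 < M) (I : Finset (Fin d → ℤ)) :
    ENNReal.ofReal ((2 * 2 ^ (α + β - γ)) ^ (-(1 / 2) : ℝ) * (M : ℝ) ^ (-(α + β - γ) / 2)) ≤
      samplingErrorNorm α β γ z M I := by
  -- The entry of larger modulus goes first: it dominates both weights, and it is nonzero because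
  -- the relation is nontrivial. On the axes the hybrid weight is `(1 + a ^ 2) ^ (α + β)`, and `1 +
  -- a ^ 2 ≤ 2 * M`.
  have key : ∀ (i i' : Fin d) (a b : ℤ), i ≠ i' → a ≠ 0 → a ^ 2 ≤ M → b ^ 2 ≤ a ^ 2 →
      a * z i ≡ b * z i' [ZMOD M] →
      ENNReal.ofReal ((2 * 2 ^ (α + β - γ)) ^ (-(1 / 2) : ℝ) * (M : ℝ) ^ (-(α + β - γ) / 2)) ≤
        samplingErrorNorm α β γ z M I := by
    intro i i' a b hi ha haM hba hmod
    have hne : (Pi.single i a : Fin d → ℤ) ≠ Pi.single i' b := by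
      intro h
      have := congrFun h i
      simp [hi] at this
      exact ha this
    refine le_trans (ENNReal.ofReal_le_ofReal ?_) (le_samplingErrorNorm_of_modEq α β γ z hM I hne
      (by rwa [latticeResidue_single, latticeResidue_single]))
    rw [hybridWeight_single, hybridWeight_single, hybridWeight_single, zero_add]
    have hM1 : (1 : ℝ) ≤ M := by exact_mod_cast hM
    have haM' : (a : ℝ) ^ 2 ≤ M := by exact_mod_cast haM
    have hba' : (b : ℝ) ^ 2 ≤ (a : ℝ) ^ 2 := by exact_mod_cast hba
    have h1 : (1 + (b : ℝ) ^ 2) ^ (α + β) ≤ (1 + (a : ℝ) ^ 2) ^ (α + β) :=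
      Real.rpow_le_rpow (by positivity) (by linarith) hαβ
    have h2 : (1 + (a : ℝ) ^ 2) ^ (α + β - γ) ≤ 2 ^ (α + β - γ) * (M : ℝ) ^ (α + β - γ) := by
      rw [← Real.mul_rpow (by norm_num) (by positivity)]
      exact Real.rpow_le_rpow (by positivity) (by linarith) (by linarith)
    have h3 : (1 + (a : ℝ) ^ 2) ^ (α + β) =
        (1 + (a : ℝ) ^ 2) ^ (α + β - γ) * (1 + (a : ℝ) ^ 2) ^ γ := by
      rw [← Real.rpow_add (by positivity), sub_add_cancel]
    have h4 : (2 * 2 ^ (α + β - γ) : ℝ) ^ (-(1 / 2) : ℝ) * (M : ℝ) ^ (-(α + β - γ) / 2) =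
        ((2 * 2 ^ (α + β - γ) * (M : ℝ) ^ (α + β - γ))⁻¹) ^ (1 / 2 : ℝ) := by
      rw [← Real.rpow_neg_one, ← Real.rpow_mul (by positivity),
        Real.mul_rpow (x := 2 * 2 ^ (α + β - γ)) (by positivity) (by positivity),
        ← Real.rpow_mul (x := (M : ℝ)) (by positivity)]
      congr 2 <;> ring
    rw [h4]
    refine Real.rpow_le_rpow (by positivity) ?_ (by norm_num)
    rw [inv_le_comm₀ (by positivity) (by positivity), inv_div, div_le_iff₀ (by positivity)]
    calc _ ≤ 2 * ((1 + (a : ℝ) ^ 2) ^ (α + β - γ) * (1 + (a : ℝ) ^ 2) ^ γ) := by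
          rw [← h3]
          linarith
      _ ≤ 2 * ((2 ^ (α + β - γ) * (M : ℝ) ^ (α + β - γ)) * (1 + (a : ℝ) ^ 2) ^ γ) := by gcongr
      _ = _ := by ring
  have hi : (⟨0, by omega⟩ : Fin d) ≠ ⟨1, by omega⟩ := by simp
  obtain ⟨a, b, hab, ha, hb, h⟩ := exists_small_relation M hM (z ⟨0, by omega⟩) (z ⟨1, by omega⟩)
  rcases le_total (b ^ 2) (a ^ 2) with hle | hle
  · refine key _ _ a b hi ?_ ha hle h
    rintro rfl
    simp_all
  · refine key _ _ b a hi.symm ?_ hb hle h.symm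
    rintro rfl
    simp_all

/-! ### The difference set and the size of CBC lattices -/

/-- The two prescribed sums determine the coordinates `i` and `i'` from the rest. This is why the
exponent is `d - 2` and why both sides of the split must be nonempty. -/
theorem card_levels_le {ι : Type*} [Fintype ι] [DecidableEq ι] (A : Finset ι) {i i' : ι}
    (hi : i ∈ A) (hi' : i' ∉ A) {T a b : ℕ} (S : Finset (ι → ℕ))
    (hST : ∀ μ ∈ S, ∀ s, μ s ≤ T) (ha : ∀ μ ∈ S, ∑ s ∈ A, μ s = a)
    (hb : ∀ μ ∈ S, ∑ s ∈ Aᶜ, μ s = b) : S.card ≤ (T + 1) ^ (Fintype.card ι - 2) := by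
  have hne : i' ≠ i := fun h => hi' (h ▸ hi)
  set E := (Finset.univ.erase i).erase i' with hE
  have hcard : (E.pi fun _ => Finset.range (T + 1)).card = (T + 1) ^ (Fintype.card ι - 2) := by
    rw [Finset.card_pi, Finset.prod_const, Finset.card_range, hE,
      Finset.card_erase_of_mem (Finset.mem_erase.2 ⟨hne, Finset.mem_univ _⟩),
      Finset.card_erase_of_mem (Finset.mem_univ _), Finset.card_univ, Nat.sub_sub]
  rw [← hcard]
  refine Finset.card_le_card_of_injOn (fun μ t _ => μ t) ?_ ?_
  · intro μ hμ
    simp only [Finset.mem_coe, Finset.mem_pi, Finset.mem_range]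
    exact fun t _ => Nat.lt_succ_of_le (hST μ hμ t)
  · intro μ hμ ν hν h
    have h1 : ∀ t, t ≠ i → t ≠ i' → μ t = ν t := fun t ht ht' =>
      congrFun (congrFun h t) (Finset.mem_erase.2 ⟨ht', Finset.mem_erase.2 ⟨ht, Finset.mem_univ t⟩⟩)
    have h2 : ∀ B : Finset ι, ∀ t ∈ B, (∀ t' ∈ B, t' ≠ t → μ t' = ν t') →
        ∑ s ∈ B, μ s = ∑ s ∈ B, ν s → μ t = ν t := by
      intro B t ht hB hsum
      rw [← Finset.add_sum_erase _ _ ht, ← Finset.add_sum_erase _ ν ht,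
        Finset.sum_congr rfl fun t' ht' =>
          hB t' (Finset.mem_erase.1 ht').2 (Finset.mem_erase.1 ht').1] at hsum
      exact Nat.add_right_cancel hsum
    funext t
    by_cases ht : t = i
    · subst ht
      exact h2 A t hi (fun t' ht' hne' => h1 t' hne' fun h => hi' (h ▸ ht'))
        ((ha μ hμ).trans (ha ν hν).symm)
    by_cases ht' : t = i'
    · subst ht'
      exact h2 Aᶜ t (Finset.mem_compl.2 hi')
        (fun t' ht' hne' => h1 t' (fun h => Finset.mem_compl.1 ht' (h ▸ hi)) hne')
        ((hb μ hμ).trans (hb ν hν).symm)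
    exact h1 t ht ht'

theorem sum_two_pow_levels_le {ι : Type*} [Fintype ι] [DecidableEq ι] (A : Finset ι) {i i' : ι}
    (hi : i ∈ A) (hi' : i' ∉ A) {T : ℕ} (S : Finset (ι → ℕ))
    (ha : ∀ μ ∈ S, ∑ s ∈ A, μ s ≤ T) (hb : ∀ μ ∈ S, ∑ s ∈ Aᶜ, μ s ≤ T) :
    ∑ μ ∈ S, 2 ^ (∑ s, μ s) ≤ 4 * 4 ^ T * (T + 1) ^ (Fintype.card ι - 2) := by
  have hST : ∀ μ ∈ S, ∀ s, μ s ≤ T := by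
    intro μ hμ s
    by_cases hs : s ∈ A
    · exact (Finset.single_le_sum (f := μ) (fun _ _ => Nat.zero_le _) hs).trans (ha μ hμ)
    · exact (Finset.single_le_sum (f := μ) (fun _ _ => Nat.zero_le _)
        (Finset.mem_compl.2 hs)).trans (hb μ hμ)
  have hmaps : ∀ μ ∈ S, (∑ s ∈ A, μ s, ∑ s ∈ Aᶜ, μ s) ∈
      Finset.range (T + 1) ×ˢ Finset.range (T + 1) := by
    intro μ hμ
    rw [Finset.mem_product, Finset.mem_range, Finset.mem_range]
    exact ⟨Nat.lt_succ_of_le (ha μ hμ), Nat.lt_succ_of_le (hb μ hμ)⟩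
  have hgeom : ∑ a ∈ Finset.range (T + 1), 2 ^ a ≤ 2 * 2 ^ T := by
    rw [← pow_succ']
    exact (Nat.geomSum_lt le_rfl fun k hk => Finset.mem_range.1 hk).le
  rw [← Finset.sum_fiberwise_of_maps_to hmaps]
  calc _ ≤ ∑ p ∈ Finset.range (T + 1) ×ˢ Finset.range (T + 1),
      2 ^ p.1 * 2 ^ p.2 * (T + 1) ^ (Fintype.card ι - 2) := by
        refine Finset.sum_le_sum fun p _ => ?_
        have hmem : ∀ μ ∈ S.filter (fun μ => (∑ s ∈ A, μ s, ∑ s ∈ Aᶜ, μ s) = p),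
            μ ∈ S ∧ ∑ s ∈ A, μ s = p.1 ∧ ∑ s ∈ Aᶜ, μ s = p.2 := by
          intro μ hμ
          rw [Finset.mem_filter] at hμ
          exact ⟨hμ.1, congrArg Prod.fst hμ.2, congrArg Prod.snd hμ.2⟩
        refine (Finset.sum_le_card_nsmul _ _ (2 ^ p.1 * 2 ^ p.2) fun μ hμ => ?_).trans ?_
        · rw [← Finset.sum_add_sum_compl A, (hmem μ hμ).2.1, (hmem μ hμ).2.2, pow_add]
        · rw [smul_eq_mul, mul_comm]
          exact Nat.mul_le_mul_left _ (card_levels_le A hi hi' _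
            (fun μ hμ => hST μ (hmem μ hμ).1) (fun μ hμ => (hmem μ hμ).2.1)
            fun μ hμ => (hmem μ hμ).2.2)
    _ = (∑ a ∈ Finset.range (T + 1), 2 ^ a) * (∑ a ∈ Finset.range (T + 1), 2 ^ a) *
        (T + 1) ^ (Fintype.card ι - 2) := by
        rw [← Finset.sum_mul, Finset.sum_mul_sum, ← Finset.sum_product']
    _ ≤ (2 * 2 ^ T) * (2 * 2 ^ T) * (T + 1) ^ (Fintype.card ι - 2) := by gcongr
    _ = _ := by
        rw [show (4 : ℕ) ^ T = 2 ^ T * 2 ^ T by rw [← mul_pow]; norm_num]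
        ring

/-- Take for `A` the set where `j` dominates `j'`: the maximum is `j` on it and `j'` off it. If one
side is empty, the maximum has total at most `T` and any singleton splits it. -/
theorem exists_proper_split {ι : Type*} [Fintype ι] [DecidableEq ι] (hι : 2 ≤ Fintype.card ι)
    (j j' : ι → ℕ) {T : ℕ} (hj : ∑ s, j s ≤ T) (hj' : ∑ s, j' s ≤ T) :
    ∃ A : Finset ι, A.Nonempty ∧ Aᶜ.Nonempty ∧
      ∑ s ∈ A, max (j s) (j' s) ≤ T ∧ ∑ s ∈ Aᶜ, max (j s) (j' s) ≤ T := by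
  have hsub : ∀ (l : ι → ℕ) (B : Finset ι), ∑ s, l s ≤ T → ∑ s ∈ B, l s ≤ T := fun l B h =>
    (Finset.sum_le_sum_of_subset (Finset.subset_univ B)).trans h
  have : Nontrivial ι := Fintype.one_lt_card_iff_nontrivial.1 hι
  obtain ⟨i, i', hii⟩ := exists_pair_ne ι
  have hall : ∑ s, max (j s) (j' s) ≤ T → ∃ A : Finset ι, A.Nonempty ∧ Aᶜ.Nonempty ∧
      ∑ s ∈ A, max (j s) (j' s) ≤ T ∧ ∑ s ∈ Aᶜ, max (j s) (j' s) ≤ T := fun h =>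
    ⟨{i}, ⟨i, by simp⟩, ⟨i', by simp [hii.symm]⟩, hsub _ _ h, hsub _ _ h⟩
  set A : Finset ι := Finset.univ.filter fun s => j' s ≤ j s with hA
  have hmaxA : ∀ s ∈ A, max (j s) (j' s) = j s := fun s hs =>
    max_eq_left (Finset.mem_filter.1 hs).2
  have hmaxA' : ∀ s ∈ Aᶜ, max (j s) (j' s) = j' s := by
    intro s hs
    simp only [hA, Finset.mem_compl, Finset.mem_filter, Finset.mem_univ, true_and, not_le] at hs
    exact max_eq_right hs.le
  by_cases h1 : A.Nonempty
  · by_cases h2 : Aᶜ.Nonempty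
    · exact ⟨A, h1, h2, by rw [Finset.sum_congr rfl hmaxA]; exact hsub _ _ hj,
        by rw [Finset.sum_congr rfl hmaxA']; exact hsub _ _ hj'⟩
    · rw [Finset.not_nonempty_iff_eq_empty, Finset.compl_eq_empty_iff] at h2
      refine hall ?_
      rwa [Finset.sum_congr rfl fun s _ => hmaxA s (h2 ▸ Finset.mem_univ s)]
  · rw [Finset.not_nonempty_iff_eq_empty] at h1
    refine hall ?_
    rwa [Finset.sum_congr rfl fun s _ => hmaxA' s (by rw [h1]; simp)]

theorem abs_sub_le_two_pow {d : ℕ} (h h' : Fin d → ℤ) (s : Fin d) :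
    |(h - h') s| ≤ 2 * 2 ^ max (dyadicIndex h s) (dyadicIndex h' s) := by
  have h1 := (abs_le_two_pow_dyadicIndex h s).trans
    (pow_le_pow_right₀ (by norm_num) (le_max_left _ (dyadicIndex h' s)))
  have h2 := (abs_le_two_pow_dyadicIndex h' s).trans
    (pow_le_pow_right₀ (by norm_num) (le_max_right (dyadicIndex h s) _))
  have h3 := abs_sub (h s) (h' s)
  rw [Pi.sub_apply]
  linarith

/-- A difference lies in a box whose exponents are the coordinatewise maxima of the two indices.
There are at most `2 ^ d` splits, and a box has at most `5 ^ d * 2 ^ (∑ s, μ s)` points. -/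
theorem card_differenceSet_le {d : ℕ} (hd : 2 ≤ d) {T : ℕ} {I : Finset (Fin d → ℤ)}
    (hI : ∀ k ∈ I, ∑ s, dyadicIndex k s ≤ T) :
    (differenceSet I).card ≤ 2 ^ d * (5 ^ d * (4 * 4 ^ T * (T + 1) ^ (d - 2))) := by
  classical
  set E : Finset (Fin d) → Finset (Fin d → ℕ) := fun A =>
    (Fintype.piFinset fun _ => Finset.range (T + 1)).filter fun μ =>
      ∑ s ∈ A, μ s ≤ T ∧ ∑ s ∈ Aᶜ, μ s ≤ T with hE
  set box : (Fin d → ℕ) → Finset (Fin d → ℤ) := fun μ =>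
    Fintype.piFinset fun s => Finset.Icc (-(2 * 2 ^ μ s) : ℤ) (2 * 2 ^ μ s) with hbox
  set 𝒜 : Finset (Finset (Fin d)) := Finset.univ.filter fun A => A.Nonempty ∧ Aᶜ.Nonempty with h𝒜
  have hsub : differenceSet I ⊆ 𝒜.biUnion fun A => (E A).biUnion box := by
    intro x hx
    obtain ⟨⟨h, h'⟩, hp, rfl⟩ := Finset.mem_image.1 hx
    rw [Finset.mem_product] at hp
    obtain ⟨A, hA, hA', h1, h2⟩ := exists_proper_split (by simpa using hd) (dyadicIndex h)
      (dyadicIndex h') (hI h hp.1) (hI h' hp.2)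
    refine Finset.mem_biUnion.2 ⟨A, by simp [h𝒜, hA, hA'], Finset.mem_biUnion.2
      ⟨fun s => max (dyadicIndex h s) (dyadicIndex h' s), ?_, ?_⟩⟩
    · refine Finset.mem_filter.2 ⟨Fintype.mem_piFinset.2 fun s => ?_, h1, h2⟩
      have e1 := Finset.single_le_sum (f := dyadicIndex h) (fun _ _ => Nat.zero_le _)
        (Finset.mem_univ s)
      have e2 := Finset.single_le_sum (f := dyadicIndex h') (fun _ _ => Nat.zero_le _)
        (Finset.mem_univ s)
      exact Finset.mem_range.2 (Nat.lt_succ_of_le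
        (max_le (e1.trans (hI h hp.1)) (e2.trans (hI h' hp.2))))
    · refine Fintype.mem_piFinset.2 fun s => Finset.mem_Icc.2 ?_
      exact abs_le.1 (abs_sub_le_two_pow h h' s)
  have hboxcard : ∀ μ, (box μ).card ≤ 5 ^ d * 2 ^ (∑ s, μ s) := by
    intro μ
    rw [hbox, Fintype.card_piFinset, ← Finset.prod_pow_eq_pow_sum]
    have h5 : (5 : ℕ) ^ d = ∏ _s : Fin d, 5 := by simp
    rw [h5, ← Finset.prod_mul_distrib]
    refine Finset.prod_le_prod' fun s _ => ?_
    have h0 : (1 : ℤ) ≤ 2 ^ μ s := one_le_pow₀ (by norm_num)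
    rw [Int.card_Icc]
    zify
    rw [Int.toNat_of_nonneg (by linarith)]
    linarith
  have hA : ∀ A ∈ 𝒜, ((E A).biUnion box).card ≤ 5 ^ d * (4 * 4 ^ T * (T + 1) ^ (d - 2)) := by
    intro A hA
    obtain ⟨⟨i, hi⟩, ⟨i', hi'⟩⟩ := (Finset.mem_filter.1 hA).2
    refine Finset.card_biUnion_le.trans ((Finset.sum_le_sum fun μ _ => hboxcard μ).trans ?_)
    rw [← Finset.mul_sum]
    have := sum_two_pow_levels_le A hi (Finset.mem_compl.1 hi') (T := T) (E A)
      (fun μ hμ => (Finset.mem_filter.1 hμ).2.1) fun μ hμ => (Finset.mem_filter.1 hμ).2.2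
    rw [Fintype.card_fin] at this
    exact Nat.mul_le_mul_left _ this
  refine (Finset.card_le_card hsub).trans ((Finset.card_biUnion_le_card_mul _ _ _ hA).trans ?_)
  refine Nat.mul_le_mul_right _ ((Finset.card_le_univ 𝒜).trans_eq ?_)
  simp

theorem freqExtent_le {d : ℕ} {T : ℕ} {I : Finset (Fin d → ℤ)}
    (hI : ∀ k ∈ I, ∑ s, dyadicIndex k s ≤ T) : freqExtent I ≤ 2 * 2 ^ T := by
  refine Finset.sup_le fun x hx => Finset.sup_le fun s _ => ?_
  obtain ⟨⟨h, h'⟩, hp, rfl⟩ := Finset.mem_image.1 hx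
  rw [Finset.mem_product] at hp
  have e1 := Finset.single_le_sum (f := dyadicIndex h) (fun _ _ => Nat.zero_le _)
    (Finset.mem_univ s)
  have e2 := Finset.single_le_sum (f := dyadicIndex h') (fun _ _ => Nat.zero_le _)
    (Finset.mem_univ s)
  have h1 := abs_sub_le_two_pow h h' s
  have h2 : (2 : ℤ) ^ max (dyadicIndex h s) (dyadicIndex h' s) ≤ 2 ^ T :=
    pow_le_pow_right₀ (by norm_num) (max_le (e1.trans (hI h hp.1)) (e2.trans (hI h' hp.2)))
  zify
  linarith

theorem IsCBCLattice.size_le_of_sum_le {d : ℕ} (hd : 2 ≤ d) {z : Fin d → ℤ} {M T : ℕ}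
    {I : Finset (Fin d → ℤ)} (h : IsCBCLattice z M I) (hI : ∀ k ∈ I, ∑ s, dyadicIndex k s ≤ T) :
    M ≤ 8 * 10 ^ d * (4 ^ T * (T + 1) ^ (d - 2)) := by
  have h1 : (differenceSet I).card ≤ 4 * 10 ^ d * (4 ^ T * (T + 1) ^ (d - 2)) := by
    refine (card_differenceSet_le hd hI).trans_eq ?_
    rw [show (10 : ℕ) ^ d = 2 ^ d * 5 ^ d by rw [← mul_pow]; norm_num]
    ring
  have h2 : freqExtent I ≤ 4 * 10 ^ d * (4 ^ T * (T + 1) ^ (d - 2)) := by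
    refine (freqExtent_le hI).trans ?_
    have e1 : 2 ^ T ≤ 4 ^ T := Nat.pow_le_pow_left (by norm_num) T
    have e2 : 1 ≤ (T + 1) ^ (d - 2) := Nat.one_le_pow _ _ (Nat.succ_pos T)
    have e3 : 1 ≤ 10 ^ d := Nat.one_le_pow _ _ (by norm_num)
    calc 2 * 2 ^ T ≤ 4 * 1 * (4 ^ T * 1) := by omega
      _ ≤ _ := by gcongr
  have h3 := max_le h1 h2
  have h4 := h.size_le
  calc M ≤ 2 * (4 * 10 ^ d * (4 ^ T * (T + 1) ^ (d - 2))) := h4.trans (Nat.mul_le_mul_left 2 h3)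
    _ = _ := by ring

/-- The `2 ^ T` frequencies `0, …, 2 ^ T - 1` on one axis need distinct residues. -/
theorem IsReconstructing.two_pow_le {d : ℕ} (hd : 1 ≤ d) {z : Fin d → ℤ} {M T : ℕ} (hM : 0 < M)
    {I : Finset (Fin d → ℤ)} (h : IsReconstructing z M I)
    (hI : ∀ k : Fin d → ℤ, ∑ s, dyadicIndex k s ≤ T → k ∈ I) : 2 ^ T ≤ M := by
  have : NeZero M := ⟨hM.ne'⟩
  set i : Fin d := ⟨0, hd⟩
  have hmem : ∀ v : ℕ, v < 2 ^ T → (Pi.single i (v : ℤ) : Fin d → ℤ) ∈ I := by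
    intro v hv
    refine hI _ ?_
    rw [Finset.sum_eq_single i]
    · refine dyadicIndex_le_of_abs_le ?_
      rw [Pi.single_eq_same, Nat.abs_cast]
      exact_mod_cast hv.le
    · intro s _ hs
      simp [dyadicIndex, hs]
    · simp
  have hcard := Finset.card_le_card_of_injOn (s := Finset.range (2 ^ T))
    (t := (Finset.univ : Finset (ZMod M)))
    (fun v => ((latticeResidue z (Pi.single i (v : ℤ)) : ℤ) : ZMod M))
    (fun _ _ => Finset.mem_coe.2 (Finset.mem_univ _)) fun v hv w hw hvw => by
      have h1 := h.eq_of_modEq hM (hmem v (by simpa using hv)) (hmem w (by simpa using hw))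
        ((ZMod.intCast_eq_intCast_iff _ _ M).1 hvw)
      have h2 := congrFun h1 i
      simpa using h2
  rwa [Finset.card_range, Finset.card_univ, ZMod.card] at hcard

/-! ### From the level to the radius and the lattice size -/

theorem le_floor_add_pred {d : ℕ} (hd : 2 ≤ d) {R : ℝ} : R ≤ ((⌊R⌋₊ + (d - 1) : ℕ) : ℝ) := by
  have h1 := (Nat.lt_floor_add_one R).le
  have h2 : (1 : ℝ) ≤ ((d - 1 : ℕ) : ℝ) := by exact_mod_cast (by omega : 1 ≤ d - 1)
  push_cast
  linarith

theorem floor_add_pred_le {d : ℕ} (hd : 1 ≤ d) {R : ℝ} (hR : 0 ≤ R) :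
    ((⌊R⌋₊ + (d - 1) : ℕ) : ℝ) + 1 ≤ R + d := by
  have h1 := Nat.floor_le hR
  rw [Nat.cast_add, Nat.cast_sub hd]
  push_cast
  linarith

theorem sqrt_logFactor_le {d : ℕ} (hd : 2 ≤ d) (β : ℝ) {R : ℝ} (hR : 1 ≤ R) :
    (logFactor d β (⌊R⌋₊ + (d - 1))) ^ (1 / 2 : ℝ) ≤
      (d + 1 : ℝ) ^ (((d : ℝ) - 1) / 2) * (if β = 0 then R ^ (((d : ℝ) - 1) / 2) else 1) := by
  have hd1 : (1 : ℝ) ≤ d := by exact_mod_cast (by omega : 1 ≤ d)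
  unfold logFactor
  split_ifs
  · have h1 := floor_add_pred_le (d := d) (by omega) (zero_le_one.trans hR)
    have h2 : R + d ≤ (d + 1) * R := by nlinarith
    rw [← Real.rpow_natCast, ← Real.rpow_mul (by positivity), Nat.cast_sub (by omega),
      ← Real.mul_rpow (by positivity) (by positivity), Nat.cast_one, mul_one_div]
    exact Real.rpow_le_rpow (by positivity) (h1.trans h2) (by linarith)
  · rw [Real.one_rpow, mul_one]
    exact Real.one_le_rpow (by linarith) (by linarith)

theorem sqrt_four_rpow_pow_le {δ R : ℝ} (hδ : 0 ≤ δ) {T : ℕ} (hT : R ≤ T) :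
    (((4 : ℝ) ^ (-δ)) ^ T) ^ (1 / 2 : ℝ) ≤ (2 : ℝ) ^ (-δ * R) := by
  rw [← Real.rpow_natCast, ← Real.rpow_mul (by positivity), ← Real.rpow_mul (by positivity),
    show (4 : ℝ) = 2 ^ (2 : ℝ) by norm_num, ← Real.rpow_mul (by norm_num)]
  refine Real.rpow_le_rpow_of_exponent_le (by norm_num) ?_
  nlinarith

theorem two_rpow_neg_le_of_size_le {d : ℕ} (hd : 2 ≤ d) {B : ℝ} (hB : 0 < B) {δ β : ℝ}
    (hδ : 0 ≤ δ) :
    ∃ C : ℝ, 0 < C ∧ ∀ R : ℝ, 1 ≤ R → ∀ M : ℕ, 2 ^ (⌊R⌋₊ + (d - 1)) ≤ M →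
      (M : ℝ) ≤ B * (4 ^ (⌊R⌋₊ + (d - 1)) * (((⌊R⌋₊ + (d - 1) : ℕ) : ℝ) + 1) ^ (d - 2)) →
        (2 : ℝ) ^ (-δ * R) * (if β = 0 then R ^ (((d : ℝ) - 1) / 2) else 1) ≤
          C * ((M : ℝ) ^ (-δ / 2) * Real.log M ^ (((d : ℝ) - 2) * δ / 2) *
            (if β = 0 then Real.log M ^ (((d : ℝ) - 1) / 2) else 1)) := by
  have hl := Real.log_pos (show (1 : ℝ) < 2 by norm_num)
  have hd2 : (2 : ℝ) ≤ d := by exact_mod_cast hd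
  -- Chosen so that `T + 1 ≤ R + d ≤ (d + 1) * R ≤ κ * log M`; the last step uses `2 ^ T ≤ M` and `R
  -- ≤ T`.
  set κ : ℝ := (d + 1) / Real.log 2 with hκ
  have hκ0 : 0 < κ := by positivity
  have hκ1 : 1 ≤ κ := by
    rw [hκ, one_le_div hl]
    have := Real.log_le_sub_one_of_pos (show (0 : ℝ) < 2 by norm_num)
    linarith
  refine ⟨(B * 4 ^ d * κ ^ (d - 2)) ^ (δ / 2) * κ ^ (((d : ℝ) - 1) / 2), by positivity,
    fun R hR M hTM hMB => ?_⟩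
  set T := ⌊R⌋₊ + (d - 1) with hT
  have hRT : R ≤ T := le_floor_add_pred hd
  have hTR : (T : ℝ) + 1 ≤ R + d := floor_add_pred_le (by omega) (zero_le_one.trans hR)
  have hTM' : (2 : ℝ) ^ T ≤ M := by exact_mod_cast hTM
  have hM0 : (0 : ℝ) < M := lt_of_lt_of_le (by positivity) hTM'
  have hlogM : R * Real.log 2 ≤ Real.log M := by
    have h1 := Real.log_le_log (by positivity) hTM'
    rw [Real.log_pow] at h1
    exact (mul_le_mul_of_nonneg_right hRT hl.le).trans h1
  have hlogM0 : 0 < Real.log M := lt_of_lt_of_le (by positivity) hlogM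
  have hRκ : (d + 1) * R ≤ κ * Real.log M := by
    rw [hκ, div_mul_eq_mul_div, le_div_iff₀ hl, mul_assoc]
    exact mul_le_mul_of_nonneg_left hlogM (by positivity)
  have hTκ : (T : ℝ) + 1 ≤ κ * Real.log M := by nlinarith
  have hRκ' : R ≤ κ * Real.log M := by nlinarith
  have h4 : (4 : ℝ) ^ T ≤ 4 ^ d * (4 : ℝ) ^ R := by
    rw [← Real.rpow_natCast, ← Real.rpow_natCast, ← Real.rpow_add (by norm_num)]
    exact Real.rpow_le_rpow_of_exponent_le (by norm_num) (by linarith)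
  have h5 : (4 : ℝ) ^ (-R) ≤ (B * 4 ^ d * κ ^ (d - 2)) * (M : ℝ)⁻¹ * Real.log M ^ (d - 2) := by
    have h6 : (M : ℝ) ≤ B * ((4 ^ d * (4 : ℝ) ^ R) * (κ * Real.log M) ^ (d - 2)) := by
      refine hMB.trans ?_
      gcongr
    rw [mul_right_comm, ← div_eq_mul_inv, le_div_iff₀ hM0]
    refine (mul_le_mul_of_nonneg_left h6 (by positivity)).trans_eq ?_
    have h7 : (4 : ℝ) ^ (-R) * 4 ^ R = 1 := by
      rw [← Real.rpow_add (by norm_num), neg_add_cancel, Real.rpow_zero]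
    rw [mul_pow]
    linear_combination (B * 4 ^ d * κ ^ (d - 2) * Real.log M ^ (d - 2)) * h7
  -- The `δ / 2`-th power of `h5`, as `4 ^ (-R * δ / 2) = 2 ^ (-δ * R)`.
  have h8 : (2 : ℝ) ^ (-δ * R) ≤ (B * 4 ^ d * κ ^ (d - 2)) ^ (δ / 2) *
      ((M : ℝ) ^ (-δ / 2) * Real.log M ^ (((d : ℝ) - 2) * δ / 2)) := by
    have h9 := Real.rpow_le_rpow (by positivity) h5 (show 0 ≤ δ / 2 by linarith)
    rw [Real.mul_rpow (by positivity) (by positivity), Real.mul_rpow (by positivity)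
      (by positivity), Real.inv_rpow (by positivity), ← Real.rpow_neg (by positivity),
      ← Real.rpow_natCast (Real.log M), ← Real.rpow_mul hlogM0.le, ← Real.rpow_mul (by norm_num),
      Nat.cast_sub hd, mul_assoc, Nat.cast_ofNat, ← mul_div_assoc ((d : ℝ) - 2), ← neg_div] at h9
    refine le_of_eq_of_le ?_ h9
    rw [show (4 : ℝ) = 2 ^ (2 : ℝ) by norm_num, ← Real.rpow_mul (by norm_num)]
    congr 1
    ring
  have h10 : (if β = 0 then R ^ (((d : ℝ) - 1) / 2) else 1) ≤ κ ^ (((d : ℝ) - 1) / 2) *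
      (if β = 0 then Real.log M ^ (((d : ℝ) - 1) / 2) else 1) := by
    split_ifs
    · rw [← Real.mul_rpow hκ0.le hlogM0.le]
      exact Real.rpow_le_rpow (by linarith) hRκ' (by linarith)
    · rw [mul_one]
      exact Real.one_le_rpow hκ1 (by linarith)
  refine (mul_le_mul h8 h10 ?_ (by positivity)).trans_eq (by ring)
  split_ifs <;> positivity

theorem mainTheorem5 (d : ℕ) (hd : 2 ≤ d) (α β γ : ℝ) (hα : 1 / 2 < α) (hβ : β ≤ 0) (hγ : 0 ≤ γ)
    (hαβ : max γ (1 / 2) < α + β) :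
    ∃ c C₁ C₂ : ℝ, 0 < c ∧ 0 < C₁ ∧ 0 < C₂ ∧
      ∀ R : ℝ, 1 ≤ R → ∀ (z : Fin d → ℤ) (M : ℕ), 0 < M →
        IsReconstructing z M (hyperbolicCross d R) →
          ENNReal.ofReal (c * (M : ℝ) ^ (-(α + β - γ) / 2))
              ≤ samplingErrorNorm α β γ z M (hyperbolicCross d R) ∧
          samplingErrorNorm α β γ z M (hyperbolicCross d R)
              ≤ ENNReal.ofReal (C₁ * ((2 : ℝ) ^ (-(α + β - γ) * R) *
                  (if β = 0 then R ^ (((d : ℝ) - 1) / 2) else 1))) ∧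
          (IsCBCLattice z M (hyperbolicCross d R) →
            (2 : ℝ) ^ (-(α + β - γ) * R) * (if β = 0 then R ^ (((d : ℝ) - 1) / 2) else 1)
              ≤ C₂ * ((M : ℝ) ^ (-(α + β - γ) / 2) *
                  Real.log M ^ (((d : ℝ) - 2) * (α + β - γ) / 2) *
                  (if β = 0 then Real.log M ^ (((d : ℝ) - 1) / 2) else 1))) := by
  obtain ⟨hδ, hhalf⟩ := max_lt_iff.1 hαβ
  have hd1 : 1 ≤ d := by omega
  have hδ0 : 0 ≤ α + β - γ := by linarith
  obtain ⟨C, hC, hupper⟩ := exists_samplingErrorNorm_le hd1 hβ hγ hhalf hδ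
  obtain ⟨C₂, hC₂, hcbc⟩ := two_rpow_neg_le_of_size_le (β := β) hd
    (show (0 : ℝ) < 8 * 10 ^ d by positivity) hδ0
  refine ⟨(2 * 2 ^ (α + β - γ)) ^ (-(1 / 2) : ℝ),
    C ^ (1 / 2 : ℝ) * (d + 1 : ℝ) ^ (((d : ℝ) - 1) / 2), C₂, by positivity, by positivity, hC₂,
    fun R hR z M hM hrec => ⟨?_, ?_, fun h => ?_⟩⟩
  · exact le_samplingErrorNorm hd (by linarith) hδ z hM _
  · have hR0 : 0 ≤ R := by linarith
    refine (hupper R hR0 z M hM hrec).trans (ENNReal.ofReal_le_ofReal ?_)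
    have hlog := logFactor_pos d β (⌊R⌋₊ + (d - 1))
    rw [Real.mul_rpow hC.le (by positivity), Real.mul_rpow (by positivity) hlog.le, mul_assoc]
    refine mul_le_mul_of_nonneg_left ?_ (by positivity)
    refine (mul_le_mul (sqrt_four_rpow_pow_le hδ0 (le_floor_add_pred hd))
      (sqrt_logFactor_le hd β hR) (by positivity) (by positivity)).trans_eq (by ring)
  · have hmem : ∀ k, k ∈ hyperbolicCross d R ↔ ∑ s, dyadicIndex k s ≤ ⌊R⌋₊ + (d - 1) :=
      fun k => mem_hyperbolicCross_iff hd1 (by linarith)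
    refine hcbc R hR M (hrec.two_pow_le hd1 hM fun k hk => (hmem k).2 hk) ?_
    exact_mod_cast h.size_le_of_sum_le hd fun k hk => (hmem k).1 hk
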